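/- **Conventions.** "Efficient" means quantum polynomial time: uniform families of polynomial-size quantum circuits over a finite gate set, written down in polynomial time by a Turing machine from the public parameters $n,m,\kappa$ in unary; $n$ is the security parameter. $H$ is the Shannon entropy in bits. An *EFI pair* is a pair of families $(\nu_{0,n})_n,(\nu_{1,n})_n$ of mixed states that are efficiently preparable, statistically far, $\|\nu_{0,n}-\nu_{1,n}\|_1\ge 1/\mathrm{poly}(n)$ for large $n$, and computationally indistinguishable (every efficient one-bit distinguisher has negligible advantage). A *PRS* with $\kappa$-bit keys is a keyed family of efficiently preparable pure states such that, for every polynomial number $t$ of copies, $|\psi_k\rangle^{\otimes t}$ with uniformly random key $k\in\{0,1\}^{\kappa}$ is computationally indistinguishable from $t$ copies of a Haar random state. Let $m=m(n)=\omega(\log n)$ and let $\{|\psi_k\rangle\}_{k\in\{0,1\}^{\kappa}}$ be a PRS on $n+m$ qubits. Let $\rho_k=\mathrm{tr}_m|\psi_k\rangle\langle\psi_k|$ be the pseudorandom density matrices obtained by tracing out $m$ qubits, and let $\nu_0=2^{-\kappa}\sum_k\rho_k$, $\nu_1=I_n/2^n$. Let $$\Lambda_p(\rho)=\Big(1-\tfrac{3p}{4}\Big)\rho+\tfrac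 p4\sum_{\alpha\in\{x,y,z\}}\sigma^\alpha\rho\,\sigma^\alpha,\qquad 0\le p\le 1,$$ where $p$ is either an arbitrary constant, or depends on $n$ in such a way that $\Lambda_{p}^{\otimes n}$ is efficiently implementable. **(1)** Let $0<c<1$ be constant. Then $\Lambda_p^{\otimes n}(\nu_0)$, $\Lambda_p^{\otimes n}(\nu_1)$ form an EFI pair whenever the PRS has key length $\kappa=\lfloor cn\rfloor$ and, for all large $n$, $$H(\{1-\tfrac{3p}4,\tfrac p4,\tfrac p4,\tfrac p4\})\le (1-c)-\frac mn-\frac2n .$$ The same holds for key length $\kappa=\lfloor c(n+m)\rfloor$ if, for all large $n$, $$H(\{1-\tfrac{3p}4,\tfrac p4,\tfrac p4,\tfrac p4\})\le (1-c)-(1+c)\frac mn-\frac2n .$$ **(2)** Let moreover $m\le\mathrm{polylog}(n)$ for all large $n$. Then there are $C\ge0$ and $d\in\mathbb N$, depending only on $m$, such that for $c=10^{-4}$ and either choice of $\kappa$ in (1), $\Lambda_p^{\otimes n}(\nu_0)$, $\Lambda_p^{\otimes n}(\nu_1)$ form an EFI pair whenever $p<\frac14-C\,\frac{(\log n)^d}{n}$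 for all large $n$. -/

import Mathlib

open MeasureTheory Filter
open scoped Matrix

namespace NoisyEFI

/-! ### Qubits, states, elementary operations -/

/-- Computational basis labels of `N` qubits. -/
abbrev Bits (N : ℕ) : Type := Fin N → Bool

/-- Operators on the `2 ^ N`-dimensional space of `N` qubits. -/
abbrev Op (N : ℕ) : Type := Matrix (Bits N) (Bits N) ℂ

/-- The rank-one operator `|ψ⟩⟨ψ|`. -/
def ketBra {N : ℕ} (ψ : Bits N → ℂ) : Op N := Matrix.vecMulVec ψ (star ψ)

/-- The basis state `|k⟩⟨k|`. -/
def basisState {N : ℕ} (k : Bits N) : Op N := Matrix.single k k 1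

/-- The vector `|ψ⟩^{⊗ t}`; qubit `j` of copy `s` is qubit `j + N * s`. -/
def copies {N : ℕ} (t : ℕ) (ψ : Bits N → ℂ) : Bits (t * N) → ℂ :=
  fun x => ∏ s : Fin t, ψ fun j => x (finProdFinEquiv (s, j))

/-- The partial trace over the last `m` of `n + m` qubits. -/
def traceOut {n m : ℕ} (X : Op (n + m)) : Op n :=
  Matrix.of fun a b => ∑ z : Bits m, X (Fin.append a z) (Fin.append b z)

/-- The maximally mixed state `I / 2 ^ n`. -/
noncomputable def maxMixed (n : ℕ) : Op n := ((2 : ℂ) ^ n)⁻¹ • (1 : Op n)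

/-- The trace norm `‖A‖₁`, the sum of the singular values of `A`. -/
noncomputable def traceNorm {N : ℕ} (A : Op N) : ℝ :=
  ∑ i, √((Matrix.isHermitian_conjTranspose_mul_self A).eigenvalues i)

/-- The Haar measure on pure states of `N` qubits: the normalised surface measure of the unit
sphere of `ℂ ^ (2 ^ N)`. -/
noncomputable def haarState (N : ℕ) :
    Measure (Metric.sphere (0 : EuclideanSpace ℂ (Bits N)) 1) :=
  ((volume : Measure (EuclideanSpace ℂ (Bits N))).toSphere Set.univ)⁻¹ •
    (volume : Measure (EuclideanSpace ℂ (Bits N))).toSphere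

/-! ### Quantum circuits and polynomial-time quantum algorithms -/

/-- A gate: an arbitrary quantum channel on two qubits, in Kraus form. Two-qubit unitaries,
one-qubit gates, measurements, resets to `|0⟩` and random choices are all of this form. -/
structure Gate where
  /-- number of Kraus operators -/
  rank : ℕ
  /-- the Kraus operators -/
  kraus : Fin rank → Matrix (Bool × Bool) (Bool × Bool) ℂ
  /-- trace preservation -/
  complete : ∑ a, (kraus a)ᴴ * kraus a = 1

/-- A circuit over a set of `r` gate symbols: a list of instructions `(g, i, j)`, meaning
"apply gate `g` to the qubits `i` and `j`, in this order". Qubits are labelled by `ℕ`. -/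
abbrev Circuit (r : ℕ) : Type := List (Fin r × ℕ × ℕ)

/-- A (density) matrix of a register with qubits labelled by `ℕ`. Only matrices in which all but
finitely many qubits are in the state `|0⟩` occur below. -/
abbrev Register : Type := (ℕ → Bool) → (ℕ → Bool) → ℂ

/-- The bit assignment `x` with the bits at `i` and `j` replaced by `u`. -/
def setPair (x : ℕ → Bool) (i j : ℕ) (u : Bool × Bool) : ℕ → Bool :=
  Function.update (Function.update x i u.1) j u.2

/-- The action `X ↦ ∑ₐ Kₐ X Kₐ†` of a gate on the qubits `i ≠ j` of a register, tensored with the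
identity on all other qubits. An instruction with `i = j` is void. -/
def Gate.apply (G : Gate) (i j : ℕ) (X : Register) : Register :=
  if i = j then X else fun x y =>
    ∑ a, ∑ u : Bool × Bool, ∑ v : Bool × Bool,
      G.kraus a (x i, x j) u * X (setPair x i j u) (setPair y i j v) *
        star (G.kraus a (y i, y j) v)

/-- Running a circuit, first instruction first; `lib` interprets the gate symbols. -/
def run {r : ℕ} (lib : Fin r → Gate) (C : Circuit r) (X : Register) : Register :=
  C.foldl (fun Y g => (lib g.1).apply g.2.1 g.2.2 Y) X

open Classical in
/-- The register holding the `N`-qubit operator `ρ` on the qubits `0, …, N - 1` and `|0⟩` on all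
other qubits. -/
noncomputable def load {N : ℕ} (ρ : Op N) : Register := fun x y =>
  if ∀ i, N ≤ i → x i = false ∧ y i = false then ρ (fun i => x i) (fun i => y i) else 0

/-- Natural numbers in unary: `[a, b, …]` is written `1ᵃ 0 1ᵇ 0 …`. -/
def encodeParams (l : List ℕ) : List Bool :=
  l.flatMap fun a => List.replicate a true ++ [false]

/-- The description of a circuit as a word over a finite alphabet: the instruction `(g, i, j)` is
written `g 1ⁱ 0 1ʲ 0`. -/
def encodeCircuit {r : ℕ} (C : Circuit r) : List (Fin r ⊕ Bool) :=
  C.flatMap fun g =>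
    Sum.inl g.1 :: (List.replicate g.2.1 (Sum.inr true) ++ Sum.inr false ::
      (List.replicate g.2.2 (Sum.inr true) ++ [Sum.inr false]))

/-- Efficient quantum algorithms, as uniform families of polynomial-size quantum circuits.
Here `n` is the security parameter and `pp n` is a list of public parameters (`n` itself among
them). The maps `Φ n`, from `N n` to `M n` qubits, are efficient if there are a finite gate set and
a Turing machine which, on input `pp n` in unary, writes down in polynomial time a circuit over
this gate set that implements `Φ n`: it takes the input on the first `N n` qubits, all other qubits
being `|0⟩`, to the output on the first `M n` qubits, all other qubits being reset to `|0⟩`. -/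
def Efficient (pp : ℕ → List ℕ) (N M : ℕ → ℕ) (Φ : ∀ n, Op (N n) → Op (M n)) : Prop :=
  ∃ (r : ℕ) (lib : Fin r → Gate) (C : List ℕ → Circuit r),
    Nonempty (Turing.TM2ComputableInPolyTime encodeParams encodeCircuit C) ∧
    ∀ n (ρ : Op (N n)), run lib (C (pp n)) (load ρ) = load (Φ n ρ)

/-- The probability that measuring a qubit in state `σ` gives `1`. -/
def acceptProb (σ : Op 1) : ℝ := (σ (fun _ => true) (fun _ => true)).re

/-- Negligible functions. -/
def Negligible (μ : ℕ → ℝ) : Prop :=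
  ∀ c : ℕ, ∃ n₀ : ℕ, ∀ n, n₀ < n → |μ n| < 1 / (n : ℝ) ^ c

/-! ### Pseudorandom states and EFI pairs -/

/-- `ψ` is a pseudorandom state (PRS) family of `N n` qubits with keys of `κ n` bits: the states
are prepared from the key by an efficient quantum algorithm, and for any polynomial number `T n` of
copies no efficient quantum algorithm `A` with one output bit distinguishes them, for a uniformly
random key, from Haar random states. -/
structure IsPRS (pp : ℕ → List ℕ) (N κ : ℕ → ℕ)
    (ψ : ∀ n, Bits (κ n) → (Bits (N n) → ℂ)) : Prop where
  unit : ∀ n k, ∑ x, ‖ψ n k x‖ ^ 2 = 1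
  generation : ∃ G : ∀ n, Op (κ n) → Op (N n), Efficient pp κ N G ∧
    ∀ n k, G n (basisState k) = ketBra (ψ n k)
  pseudorandom : ∀ T : ℕ → ℕ, (∃ P : Polynomial ℕ, ∀ n, T n = P.eval n) →
    ∀ A : ∀ n, Op (T n * N n) → Op 1,
      Efficient pp (fun n => T n * N n) (fun _ => 1) A →
      Negligible fun n =>
        ((2 : ℝ) ^ κ n)⁻¹ * ∑ k, acceptProb (A n (ketBra (copies (T n) (ψ n k)))) -
          ∫ v, acceptProb (A n (ketBra (copies (T n) fun x => v.1 x))) ∂(haarState (N n))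

/-- EFI pairs of `N n`-qubit mixed states `ν b n`, `b ∈ {0, 1}`: efficiently generated,
statistically far (at trace-norm distance at least an inverse polynomial in the security parameter
`n`), and computationally indistinguishable. -/
structure IsEFIPair (pp : ℕ → List ℕ) (N : ℕ → ℕ) (ν : Bool → ∀ n, Op (N n)) : Prop where
  generation : ∀ b, ∃ G : ∀ n, Op 0 → Op (N n), Efficient pp (fun _ => 0) N G ∧
    ∀ n, G n 1 = ν b n
  far : ∃ d : ℕ, ∀ᶠ n : ℕ in atTop, 1 / (n : ℝ) ^ d ≤ traceNorm (ν false n - ν true n)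
  indistinguishable : ∀ A : ∀ n, Op (N n) → Op 1, Efficient pp N (fun _ => 1) A →
    Negligible fun n => acceptProb (A n (ν false n)) - acceptProb (A n (ν true n))

/-- The PRDM `ρ_k = tr_m |ψ_k⟩⟨ψ_k|` obtained by tracing out `m n` qubits of `ψ`. -/
def prdm {m κ : ℕ → ℕ} (ψ : ∀ n, Bits (κ n) → (Bits (n + m n) → ℂ)) (n : ℕ)
    (k : Bits (κ n)) : Op n :=
  traceOut (ketBra (ψ n k))

/-- The pair consisting of the PRDM for a uniformly random (unknown) key, `2^{-κ} ∑ₖ ρ_k`, and of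
the maximally mixed state. -/
noncomputable def prdmPair {m κ : ℕ → ℕ} (ψ : ∀ n, Bits (κ n) → (Bits (n + m n) → ℂ)) :
    Bool → ∀ n, Op n
  | false, n => ((2 : ℂ) ^ κ n)⁻¹ • ∑ k, prdm ψ n k
  | true, n => maxMixed n

/-! ### Local depolarizing noise -/

/-- The Pauli matrices `1, σˣ, σʸ, σᶻ`; `false` and `true` label `|0⟩` and `|1⟩`. -/
noncomputable def pauli : Fin 4 → Matrix Bool Bool ℂ :=
  ![1,
    Matrix.of fun a b => if a = b then 0 else 1,
    Matrix.of fun a b => if a = b then 0 else if b then -Complex.I else Complex.I,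
    Matrix.of fun a b => if a = b then (if b then -1 else 1) else 0]

/-- The weights of the single-qubit depolarizing channel
`Λ_p(ρ) = (1 - 3p/4) ρ + (p/4) ∑_{α = x, y, z} σᵅ ρ σᵅ`. -/
noncomputable def depolWeight (p : ℝ) : Fin 4 → ℝ := ![1 - 3 * p / 4, p / 4, p / 4, p / 4]

/-- The tensor product `σ^{s 0} ⊗ ⋯ ⊗ σ^{s (n - 1)}` of Pauli matrices. -/
noncomputable def pauliString {n : ℕ} (s : Fin n → Fin 4) : Op n :=
  Matrix.of fun x y => ∏ i, pauli (s i) (x i) (y i)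

/-- Local depolarizing noise `Λ_p^{⊗ n}`, expanded into the tensor products of the Kraus operators
of `Λ_p`. -/
noncomputable def localDepolarizing (p : ℝ) (n : ℕ) (ρ : Op n) : Op n :=
  ∑ s : Fin n → Fin 4,
    ((∏ i, depolWeight p (s i) : ℝ) : ℂ) • (pauliString s * ρ * (pauliString s)ᴴ)

/-- Shannon entropy in bits. -/
noncomputable def shannonEntropy {ι : Type*} [Fintype ι] (q : ι → ℝ) : ℝ :=
  ∑ i, Real.negMulLog (q i) / Real.log 2

/-- Depolarizing probabilities `p n ∈ [0, 1]` that are either constant (an arbitrary real), or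
vary with `n` in such a way that the noise `Λ_{p n}^{⊗ n}` is efficiently implementable. -/
def IsNoiseRate (pp : ℕ → List ℕ) (p : ℕ → ℝ) : Prop :=
  (∀ n, 0 ≤ p n ∧ p n ≤ 1) ∧
    ((∃ q, ∀ n, p n = q) ∨
      Efficient pp (fun n => n) (fun n => n) fun n => localDepolarizing (p n) n)

/-- The public parameters of the construction. -/
def params (m κ : ℕ → ℕ) (n : ℕ) : List ℕ := [n, m n, κ n]

/-- The PRDM pair remains an EFI pair after local depolarizing noise of strength `p n` on all `n`
qubits of both states. -/
def RobustEFI {m κ : ℕ → ℕ} (ψ : ∀ n, Bits (κ n) → (Bits (n + m n) → ℂ)) (p : ℕ → ℝ) : Prop :=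
  IsEFIPair (params m κ) (fun n => n) fun b n => localDepolarizing (p n) n (prdmPair ψ b n)

end NoisyEFI

namespace NoisyEFI

/-! Noise that is efficient to implement can be absorbed into any distinguisher, so efficient
generation and indistinguishability survive at every admissible rate; only the trace distance
depends on the entropy of the noise.

Indistinguishability uses a single copy of the PRS. A distinguisher preceded by noise and partial
trace is an efficient test of $|\psi_k\rangle$ against a Haar random state. By symmetry of the
sphere the first Haar moment is maximally mixed (`integral_haarState_coord`); partial trace maps it
to a maximally mixed state, and Pauli noise fixes that (`localDepolarizing_maxMixed`).

For the distance (`le_traceNorm_noisy`), the noisy mixture is a weighted sum of rank-one operators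
indexed by a key, a basis string of the traced-out qubits and a Pauli string $s$ of product weight
$w(s)$. Let $S$ be the strings with $w(s)\ge 2^{-t}$. If the entropy of $w$ is at most $t-1$ bits,
then $w(S)\ge 1/t$ (`inv_le_sum_typical`), while $|S|\le 2^t w(S)$. The vectors with $s\in S$ span a
space of dimension at most $2^{\kappa+m}|S|$. With $t=n-\kappa-m-1$ the projection onto it has
expectation at least $w(S)$ in the noisy state and at most $w(S)/2$ in the maximally mixed one, so
the distance is at least $1/(2n)$.

Part (2) needs no correction term: at $p=1/4$ the noise entropy is already strictly below 1
(`shannonEntropy_depolWeight_le`), and the gap exceeds $\kappa/n+m/n+2/n$ for large $n$.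

Since efficiency asks for actual Turing machines, two machine constructions are needed:
concatenation of circuit descriptions, which gives closure under composition (`polyTime_concat`,
`Efficient.comp`), and a writer for layers of one-qubit gates (`polyTime_ladder`). Such layers
realise partial trace, noise of constant strength, and uniformly random bits. -/

/-! ### Running Turing machines -/

/-- `RunsIn f n a b`: iterating the partial step function `f` leads from `a` to `b` in `n` steps. -/
inductive RunsIn {σ : Type*} (f : σ → Option σ) : ℕ → σ → σ → Prop
  | refl (a : σ) : RunsIn f 0 a a
  | head {n : ℕ} {a b c : σ} : f a = some b → RunsIn f n b c → RunsIn f (n + 1) a c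

namespace RunsIn

variable {σ : Type*} {f : σ → Option σ}

theorem trans {n k : ℕ} {a b c : σ} (h : RunsIn f n a b) (h' : RunsIn f k b c) :
    RunsIn f (n + k) a c := by
  induction h with
  | refl a => simpa using h'
  | head h1 _ ih =>
    rw [Nat.add_right_comm]
    exact .head h1 (ih h')

theorem single {a b : σ} (h : f a = some b) : RunsIn f 1 a b := .head h (.refl b)

theorem cast {n k : ℕ} {a b : σ} (h : RunsIn f n a b) (e : n = k) : RunsIn f k a b := e ▸ h

theorem iterate {n : ℕ} {a b : σ} (h : RunsIn f n a b) :
    (flip Bind.bind f)^[n] (some a) = some b := by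
  induction h with
  | refl a => rfl
  | head h1 _ ih =>
    rw [Function.iterate_succ_apply]
    simpa [flip, h1] using ih

theorem of_iterate {n : ℕ} {a b : σ} (h : (flip Bind.bind f)^[n] (some a) = some b) :
    RunsIn f n a b := by
  induction n generalizing a with
  | zero => cases h; exact .refl _
  | succ n ih =>
    rw [Function.iterate_succ_apply] at h
    rcases ha : f a with _ | c
    -- A halted computation stays `none`, so it cannot reach `some b` later.
    · have h0 : ∀ k, (flip Bind.bind f)^[k] (none : Option σ) = none := by
        intro k
        induction k with
        | zero => rfl
        | succ k ihk => rw [Function.iterate_succ_apply]; exact ihk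
      have : flip Bind.bind f (some a) = none := by simpa [flip] using ha
      rw [this, h0] at h
      cases h
    · have : flip Bind.bind f (some a) = some c := by simpa [flip] using ha
      rw [this] at h
      exact .head ha (ih h)

/-- Simulation: a map that commutes with steps transports runs. -/
theorem map {τ : Type*} {g : τ → Option τ} (φ : σ → τ)
    (hφ : ∀ a b, f a = some b → g (φ a) = some (φ b)) {n : ℕ} {a b : σ} (h : RunsIn f n a b) :
    RunsIn g n (φ a) (φ b) := by
  induction h with
  | refl a => exact .refl _
  | head h1 _ ih => exact .head (hφ _ _ h1) ih

end RunsIn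

/-! ### Growth of stacks along a run -/

section StackSize

open Turing Turing.TM2

variable {K : Type} [DecidableEq K] {Γ : K → Type} {Λ σ : Type}

/-- The number of `push` instructions in a statement. -/
def pushCount : Stmt Γ Λ σ → ℕ
  | .push _ _ q => pushCount q + 1
  | .peek _ _ q => pushCount q
  | .pop _ _ q => pushCount q
  | .load _ q => pushCount q
  | .branch _ q₁ q₂ => pushCount q₁ + pushCount q₂
  | .goto _ => 0
  | .halt => 0

theorem length_stepAux_le (q : Stmt Γ Λ σ) (v : σ) (S : ∀ k, List (Γ k)) (k : K) :
    ((stepAux q v S).stk k).length ≤ (S k).length + pushCount q := by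
  induction q generalizing v S with
  | push j f q ih =>
    refine (ih _ _).trans ?_
    rcases eq_or_ne k j with rfl | h
    · simp [pushCount]; omega
    · simp [pushCount, h]
  | peek j f q ih => exact ih _ _
  | pop j f q ih =>
    refine (ih _ _).trans ?_
    rcases eq_or_ne k j with rfl | h
    · simp [pushCount]
    · simp [pushCount, h]
  | load f q ih => exact ih _ _
  | branch f q₁ q₂ ih₁ ih₂ =>
    have h₁ := ih₁ v S
    have h₂ := ih₂ v S
    simp only [pushCount, stepAux]
    cases f v <;> simp only [cond_true, cond_false] <;> omega
  | goto f => simp [pushCount]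
  | halt => simp [pushCount]

/-- Each step pushes boundedly many symbols. This bounds the output of a machine by its running
time, which is what makes copying that output affordable. -/
theorem RunsIn.length_stk_le [Fintype Λ] (M : Λ → Stmt Γ Λ σ) {n : ℕ} {a b : Cfg Γ Λ σ}
    (h : RunsIn (step M) n a b) (k : K) :
    (b.stk k).length ≤ (a.stk k).length + n * ∑ l, pushCount (M l) := by
  induction h with
  | refl a => simp
  | @head n a b c h1 _ ih =>
    rcases a with ⟨_ | l, v, S⟩
    · simp at h1
    · simp only [step, Option.some.injEq] at h1
      subst h1
      have h2 := length_stepAux_le (M l) v S k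
      have h3 : pushCount (M l) ≤ ∑ l, pushCount (M l) :=
        Finset.single_le_sum (f := fun l => pushCount (M l)) (fun _ _ => Nat.zero_le _)
          (Finset.mem_univ l)
      refine ih.trans ?_
      rw [Nat.succ_mul]
      simp only
      omega

end StackSize

section Stacks

open Turing

theorem initList_stk (M : FinTM2) (s : List (M.Γ M.k₀)) :
    (initList M s).stk = Function.update (fun _ => []) M.k₀ s := by
  funext k
  by_cases h : k = M.k₀
  · subst h; simp [initList]
  · simp [initList, h]

theorem haltList_stk (M : FinTM2) (s : List (M.Γ M.k₁)) :
    (haltList M s).stk = Function.update (fun _ => []) M.k₁ s := by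
  funext k
  by_cases h : k = M.k₁
  · subst h; simp [haltList]
  · simp [haltList, h]

end Stacks

/-! ### Concatenating the outputs of two Turing machines -/

section Concat

open Turing Turing.TM2

variable (M₁ M₂ : FinTM2) (A B : Type)

/-- Stacks of the concatenation machine: those of both machines, the input and a copy of it
(over `A`), a buffer and the output (over `B`). -/
abbrev CatK : Type := (M₁.K ⊕ M₂.K) ⊕ (Bool ⊕ Bool)

/-- Stack alphabets of the concatenation machine. -/
abbrev CatΓ : CatK M₁ M₂ → Type
  | .inl (.inl k) => M₁.Γ k
  | .inl (.inr k) => M₂.Γ k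
  | .inr (.inl _) => A
  | .inr (.inr _) => B

/-- Labels of the concatenation machine. -/
abbrev CatΛ : Type := (M₁.Λ ⊕ M₂.Λ) ⊕ Fin 6

/-- Internal states of the concatenation machine. -/
abbrev Catσ : Type := (M₁.σ × M₂.σ) × (Option A × Option B)

variable {M₁ M₂ A B}

/-- The stacks of the concatenation machine, from those of the machines and the four others. -/
def catStk (S₁ : ∀ k, List (M₁.Γ k)) (S₂ : ∀ k, List (M₂.Γ k)) (a a' : List A) (b b' : List B) :
    ∀ k, List (CatΓ M₁ M₂ A B k)
  | .inl (.inl k) => S₁ k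
  | .inl (.inr k) => S₂ k
  | .inr (.inl false) => a
  | .inr (.inl true) => a'
  | .inr (.inr false) => b
  | .inr (.inr true) => b'

section Update

variable (S₁ : ∀ k, List (M₁.Γ k)) (S₂ : ∀ k, List (M₂.Γ k)) (a a' : List A) (b b' : List B)

@[simp] theorem catStk_fst (k : M₁.K) : catStk S₁ S₂ a a' b b' (.inl (.inl k)) = S₁ k := rfl
@[simp] theorem catStk_snd (k : M₂.K) : catStk S₁ S₂ a a' b b' (.inl (.inr k)) = S₂ k := rfl
@[simp] theorem catStk_a : catStk S₁ S₂ a a' b b' (.inr (.inl false)) = a := rfl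
@[simp] theorem catStk_a' : catStk S₁ S₂ a a' b b' (.inr (.inl true)) = a' := rfl
@[simp] theorem catStk_b : catStk S₁ S₂ a a' b b' (.inr (.inr false)) = b := rfl
@[simp] theorem catStk_b' : catStk S₁ S₂ a a' b b' (.inr (.inr true)) = b' := rfl

@[simp] theorem update_catStk_fst (k : M₁.K) (x : List (M₁.Γ k)) :
    Function.update (catStk S₁ S₂ a a' b b') (.inl (.inl k)) x =
      catStk (Function.update S₁ k x) S₂ a a' b b' := by
  funext j
  rcases j with (j | j) | (_ | _) | (_ | _)
  · rcases eq_or_ne j k with rfl | h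
    · simp
    · simp [h]
  all_goals rfl

@[simp] theorem update_catStk_snd (k : M₂.K) (x : List (M₂.Γ k)) :
    Function.update (catStk S₁ S₂ a a' b b') (.inl (.inr k)) x =
      catStk S₁ (Function.update S₂ k x) a a' b b' := by
  funext j
  rcases j with (j | j) | (_ | _) | (_ | _)
  · rfl
  · rcases eq_or_ne j k with rfl | h
    · simp
    · simp [h]
  all_goals rfl

@[simp] theorem update_catStk_a (x : List A) :
    Function.update (catStk S₁ S₂ a a' b b') (.inr (.inl false)) x =
      catStk S₁ S₂ x a' b b' := by
  funext j
  rcases j with (j | j) | (_ | _) | (_ | _) <;> rfl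

@[simp] theorem update_catStk_a' (x : List A) :
    Function.update (catStk S₁ S₂ a a' b b') (.inr (.inl true)) x =
      catStk S₁ S₂ a x b b' := by
  funext j
  rcases j with (j | j) | (_ | _) | (_ | _) <;> rfl

@[simp] theorem update_catStk_b (x : List B) :
    Function.update (catStk S₁ S₂ a a' b b') (.inr (.inr false)) x =
      catStk S₁ S₂ a a' x b' := by
  funext j
  rcases j with (j | j) | (_ | _) | (_ | _) <;> rfl

@[simp] theorem update_catStk_b' (x : List B) :
    Function.update (catStk S₁ S₂ a a' b b') (.inr (.inr true)) x =
      catStk S₁ S₂ a a' b x := by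
  funext j
  rcases j with (j | j) | (_ | _) | (_ | _) <;> rfl

end Update

/-- Statements of the first machine, as statements of the concatenation machine. -/
def trFst : Stmt M₁.Γ M₁.Λ M₁.σ → Stmt (CatΓ M₁ M₂ A B) (CatΛ M₁ M₂) (Catσ M₁ M₂ A B)
  | .push k f q => .push (.inl (.inl k)) (fun v => f v.1.1) (trFst q)
  | .peek k f q => .peek (.inl (.inl k)) (fun v x => ((f v.1.1 x, v.1.2), v.2)) (trFst q)
  | .pop k f q => .pop (.inl (.inl k)) (fun v x => ((f v.1.1 x, v.1.2), v.2)) (trFst q)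
  | .load f q => .load (fun v => ((f v.1.1, v.1.2), v.2)) (trFst q)
  | .branch f q₁ q₂ => .branch (fun v => f v.1.1) (trFst q₁) (trFst q₂)
  | .goto f => .goto fun v => .inl (.inl (f v.1.1))
  | .halt => .goto fun _ => .inl (.inr M₂.main)

/-- Statements of the second machine, as statements of the concatenation machine. -/
def trSnd : Stmt M₂.Γ M₂.Λ M₂.σ → Stmt (CatΓ M₁ M₂ A B) (CatΛ M₁ M₂) (Catσ M₁ M₂ A B)
  | .push k f q => .push (.inl (.inr k)) (fun v => f v.1.2) (trSnd q)
  | .peek k f q => .peek (.inl (.inr k)) (fun v x => ((v.1.1, f v.1.2 x), v.2)) (trSnd q)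
  | .pop k f q => .pop (.inl (.inr k)) (fun v x => ((v.1.1, f v.1.2 x), v.2)) (trSnd q)
  | .load f q => .load (fun v => ((v.1.1, f v.1.2), v.2)) (trSnd q)
  | .branch f q₁ q₂ => .branch (fun v => f v.1.2) (trSnd q₁) (trSnd q₂)
  | .goto f => .goto fun v => .inl (.inr (f v.1.2))
  | .halt => .goto fun _ => .inr 2

/-- Configurations of the first machine inside the concatenation machine. -/
def embFst (w : M₂.σ × (Option A × Option B)) (S₂ : ∀ k, List (M₂.Γ k)) (a a' : List A)
    (b b' : List B) (c : Cfg M₁.Γ M₁.Λ M₁.σ) :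
    Cfg (CatΓ M₁ M₂ A B) (CatΛ M₁ M₂) (Catσ M₁ M₂ A B) :=
  ⟨some (c.l.elim (.inl (.inr M₂.main)) fun l => .inl (.inl l)), ((c.var, w.1), w.2),
    catStk c.stk S₂ a a' b b'⟩

/-- Configurations of the second machine inside the concatenation machine. -/
def embSnd (w : M₁.σ × (Option A × Option B)) (S₁ : ∀ k, List (M₁.Γ k)) (a a' : List A)
    (b b' : List B) (c : Cfg M₂.Γ M₂.Λ M₂.σ) :
    Cfg (CatΓ M₁ M₂ A B) (CatΛ M₁ M₂) (Catσ M₁ M₂ A B) :=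
  ⟨some (c.l.elim (.inr 2) fun l => .inl (.inr l)), ((w.1, c.var), w.2),
    catStk S₁ c.stk a a' b b'⟩

/-- `halt` is translated into a jump to the second machine, and `embFst` places halted
configurations at that very label. The simulation is therefore step for step, with no exceptional
last step. -/
theorem stepAux_trFst (w : M₂.σ × (Option A × Option B)) (S₂ : ∀ k, List (M₂.Γ k))
    (a a' : List A) (b b' : List B) (q : Stmt M₁.Γ M₁.Λ M₁.σ) (v : M₁.σ)
    (S : ∀ k, List (M₁.Γ k)) :
    stepAux (trFst q) ((v, w.1), w.2) (catStk S S₂ a a' b b') =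
      embFst w S₂ a a' b b' (stepAux q v S) := by
  induction q generalizing v S with
  | branch f q₁ q₂ ih₁ ih₂ =>
    simp only [trFst, stepAux]
    cases f v <;> simp [ih₁, ih₂]
  | goto f => rfl
  | halt => rfl
  | _ => simp_all [trFst]

theorem stepAux_trSnd (w : M₁.σ × (Option A × Option B)) (S₁ : ∀ k, List (M₁.Γ k))
    (a a' : List A) (b b' : List B) (q : Stmt M₂.Γ M₂.Λ M₂.σ) (v : M₂.σ)
    (S : ∀ k, List (M₂.Γ k)) :
    stepAux (trSnd q) ((w.1, v), w.2) (catStk S₁ S a a' b b') =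
      embSnd w S₁ a a' b b' (stepAux q v S) := by
  induction q generalizing v S with
  | branch f q₁ q₂ ih₁ ih₂ =>
    simp only [trSnd, stepAux]
    cases f v <;> simp [ih₁, ih₂]
  | goto f => rfl
  | halt => rfl
  | _ => simp_all [trSnd]

variable [Inhabited A] [Inhabited B]

/-- The program of the concatenation machine: duplicate the input, run both machines, and copy
their outputs, the second one first, to the output stack. -/
def catProg (i₁ : A → M₁.Γ M₁.k₀) (i₂ : A → M₂.Γ M₂.k₀) (o₁ : M₁.Γ M₁.k₁ → B)
    (o₂ : M₂.Γ M₂.k₁ → B) :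
    CatΛ M₁ M₂ → Stmt (CatΓ M₁ M₂ A B) (CatΛ M₁ M₂) (Catσ M₁ M₂ A B)
  | .inl (.inl l) => trFst (M₁.m l)
  | .inl (.inr l) => trSnd (M₂.m l)
  -- Moving a stack reverses it. Labels 0 and 1 reverse the input twice, so both machines receive it
  -- in the original order.
  | .inr 0 => .pop (.inr (.inl false)) (fun v x => (v.1, x, v.2.2)) <|
      .branch (fun v => v.2.1.isSome)
        (.push (.inr (.inl true)) (fun v => v.2.1.getD default) <| .goto fun _ => .inr 0)
        (.goto fun _ => .inr 1)
  | .inr 1 => .pop (.inr (.inl true)) (fun v x => (v.1, x, v.2.2)) <|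
      .branch (fun v => v.2.1.isSome)
        (.push (.inl (.inl M₁.k₀)) (fun v => i₁ (v.2.1.getD default)) <|
          .push (.inl (.inr M₂.k₀)) (fun v => i₂ (v.2.1.getD default)) <|
            .goto fun _ => .inr 1)
        (.goto fun _ => .inl (.inl M₁.main))
  -- Each output passes through the buffer to undo the reversal. The second output is pushed first
  -- because it has to lie below the first on the output stack.
  | .inr 2 => .pop (.inl (.inr M₂.k₁)) (fun v x => (v.1, v.2.1, x.map o₂)) <|
      .branch (fun v => v.2.2.isSome)
        (.push (.inr (.inr false)) (fun v => v.2.2.getD default) <| .goto fun _ => .inr 2)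
        (.goto fun _ => .inr 3)
  | .inr 3 => .pop (.inr (.inr false)) (fun v x => (v.1, v.2.1, x)) <|
      .branch (fun v => v.2.2.isSome)
        (.push (.inr (.inr true)) (fun v => v.2.2.getD default) <| .goto fun _ => .inr 3)
        (.goto fun _ => .inr 4)
  | .inr 4 => .pop (.inl (.inl M₁.k₁)) (fun v x => (v.1, v.2.1, x.map o₁)) <|
      .branch (fun v => v.2.2.isSome)
        (.push (.inr (.inr false)) (fun v => v.2.2.getD default) <| .goto fun _ => .inr 4)
        (.goto fun _ => .inr 5)
  | .inr 5 => .pop (.inr (.inr false)) (fun v x => (v.1, v.2.1, x)) <|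
      .branch (fun v => v.2.2.isSome)
        (.push (.inr (.inr true)) (fun v => v.2.2.getD default) <| .goto fun _ => .inr 5)
        .halt

section Phases

variable (i₁ : A → M₁.Γ M₁.k₀) (i₂ : A → M₂.Γ M₂.k₀) (o₁ : M₁.Γ M₁.k₁ → B)
    (o₂ : M₂.Γ M₂.k₁ → B) (v : M₁.σ × M₂.σ)

theorem runsIn_catProg_zero (S₁ : ∀ k, List (M₁.Γ k)) (S₂ : ∀ k, List (M₂.Γ k))
    (a a' : List A) (b b' : List B) (x : Option A) :
    RunsIn (step (catProg i₁ i₂ o₁ o₂)) (a.length + 1)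
      ⟨some (.inr 0), (v, x, none), catStk S₁ S₂ a a' b b'⟩
      ⟨some (.inr 1), (v, none, none), catStk S₁ S₂ [] (a.reverse ++ a') b b'⟩ := by
  induction a generalizing a' x with
  | nil => exact .single (by simp [catProg])
  | cons y a ih =>
    refine .head (b := ⟨some (.inr 0), (v, some y, none), catStk S₁ S₂ a (y :: a') b b'⟩)
      (by simp [catProg]) ?_
    simpa using ih (y :: a') (some y)

theorem runsIn_catProg_one (s₁ : List (M₁.Γ M₁.k₀)) (s₂ : List (M₂.Γ M₂.k₀))
    (a' : List A) (b b' : List B) (x : Option A) :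
    RunsIn (step (catProg i₁ i₂ o₁ o₂)) (a'.length + 1)
      ⟨some (.inr 1), (v, x, none), catStk (Function.update (fun _ => []) M₁.k₀ s₁)
        (Function.update (fun _ => []) M₂.k₀ s₂) [] a' b b'⟩
      ⟨some (.inl (.inl M₁.main)), (v, none, none),
        catStk (Function.update (fun _ => []) M₁.k₀ ((a'.map i₁).reverse ++ s₁))
        (Function.update (fun _ => []) M₂.k₀ ((a'.map i₂).reverse ++ s₂)) [] [] b b'⟩ := by
  induction a' generalizing s₁ s₂ x with
  | nil => exact .single (by simp [catProg])
  | cons y a ih =>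
    refine .head (b := ⟨some (.inr 1), (v, some y, none),
      catStk (Function.update (fun _ => []) M₁.k₀ (i₁ y :: s₁))
        (Function.update (fun _ => []) M₂.k₀ (i₂ y :: s₂)) [] a b b'⟩)
      (by simp [catProg]) ?_
    simpa using ih (i₁ y :: s₁) (i₂ y :: s₂) (some y)

theorem runsIn_catProg_two (S₁ : ∀ k, List (M₁.Γ k)) (s : List (M₂.Γ M₂.k₁))
    (a a' : List A) (b b' : List B) (x : Option B) :
    RunsIn (step (catProg i₁ i₂ o₁ o₂)) (s.length + 1)
      ⟨some (.inr 2), (v, none, x),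
        catStk S₁ (Function.update (fun _ => []) M₂.k₁ s) a a' b b'⟩
      ⟨some (.inr 3), (v, none, none),
        catStk S₁ (fun _ => []) a a' ((s.map o₂).reverse ++ b) b'⟩ := by
  induction s generalizing b x with
  | nil => exact .single (by simp [catProg])
  | cons y s ih =>
    refine .head (b := ⟨some (.inr 2), (v, none, some (o₂ y)),
      catStk S₁ (Function.update (fun _ => []) M₂.k₁ s) a a' (o₂ y :: b) b'⟩)
      (by simp [catProg]) ?_
    simpa using ih (o₂ y :: b) (some (o₂ y))

theorem runsIn_catProg_three (S₁ : ∀ k, List (M₁.Γ k)) (S₂ : ∀ k, List (M₂.Γ k))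
    (a a' : List A) (b b' : List B) (x : Option B) :
    RunsIn (step (catProg i₁ i₂ o₁ o₂)) (b.length + 1)
      ⟨some (.inr 3), (v, none, x), catStk S₁ S₂ a a' b b'⟩
      ⟨some (.inr 4), (v, none, none), catStk S₁ S₂ a a' [] (b.reverse ++ b')⟩ := by
  induction b generalizing b' x with
  | nil => exact .single (by simp [catProg])
  | cons y b ih =>
    refine .head (b := ⟨some (.inr 3), (v, none, some y), catStk S₁ S₂ a a' b (y :: b')⟩)
      (by simp [catProg]) ?_
    simpa using ih (y :: b') (some y)

theorem runsIn_catProg_four (S₂ : ∀ k, List (M₂.Γ k)) (s : List (M₁.Γ M₁.k₁))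
    (a a' : List A) (b b' : List B) (x : Option B) :
    RunsIn (step (catProg i₁ i₂ o₁ o₂)) (s.length + 1)
      ⟨some (.inr 4), (v, none, x),
        catStk (Function.update (fun _ => []) M₁.k₁ s) S₂ a a' b b'⟩
      ⟨some (.inr 5), (v, none, none),
        catStk (fun _ => []) S₂ a a' ((s.map o₁).reverse ++ b) b'⟩ := by
  induction s generalizing b x with
  | nil => exact .single (by simp [catProg])
  | cons y s ih =>
    refine .head (b := ⟨some (.inr 4), (v, none, some (o₁ y)),
      catStk (Function.update (fun _ => []) M₁.k₁ s) S₂ a a' (o₁ y :: b) b'⟩)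
      (by simp [catProg]) ?_
    simpa using ih (o₁ y :: b) (some (o₁ y))

theorem runsIn_catProg_five (S₁ : ∀ k, List (M₁.Γ k)) (S₂ : ∀ k, List (M₂.Γ k))
    (a a' : List A) (b b' : List B) (x : Option B) :
    RunsIn (step (catProg i₁ i₂ o₁ o₂)) (b.length + 1)
      ⟨some (.inr 5), (v, none, x), catStk S₁ S₂ a a' b b'⟩
      ⟨none, (v, none, none), catStk S₁ S₂ a a' [] (b.reverse ++ b')⟩ := by
  induction b generalizing b' x with
  | nil => exact .single (by simp [catProg])
  | cons y b ih =>
    refine .head (b := ⟨some (.inr 5), (v, none, some y), catStk S₁ S₂ a a' b (y :: b')⟩)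
      (by simp [catProg]) ?_
    simpa using ih (y :: b') (some y)

theorem runsIn_catProg_fst {n : ℕ} {c c' : Cfg M₁.Γ M₁.Λ M₁.σ} (h : RunsIn (step M₁.m) n c c')
    (w : M₂.σ × (Option A × Option B)) (S₂ : ∀ k, List (M₂.Γ k)) (a a' : List A)
    (b b' : List B) :
    RunsIn (step (catProg i₁ i₂ o₁ o₂)) n (embFst w S₂ a a' b b' c)
      (embFst w S₂ a a' b b' c') := by
  refine h.map (embFst w S₂ a a' b b') fun c c' hc => ?_
  rcases c with ⟨_ | l, u, S⟩
  · simp at hc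
  · simp only [step, Option.some.injEq] at hc
    subst hc
    rw [← stepAux_trFst]
    rfl

theorem runsIn_catProg_snd {n : ℕ} {c c' : Cfg M₂.Γ M₂.Λ M₂.σ} (h : RunsIn (step M₂.m) n c c')
    (w : M₁.σ × (Option A × Option B)) (S₁ : ∀ k, List (M₁.Γ k)) (a a' : List A)
    (b b' : List B) :
    RunsIn (step (catProg i₁ i₂ o₁ o₂)) n (embSnd w S₁ a a' b b' c)
      (embSnd w S₁ a a' b b' c') := by
  refine h.map (embSnd w S₁ a a' b b') fun c c' hc => ?_
  rcases c with ⟨_ | l, u, S⟩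
  · simp at hc
  · simp only [step, Option.some.injEq] at hc
    subst hc
    rw [← stepAux_trSnd]
    rfl

/-- A proper halting configuration has its initial internal state and nothing on any stack but the
output. Both machines end this way and every transfer loop empties its source and resets its scratch
cell, so the combined run ends this way too. -/
theorem runsIn_catProg {n₁ n₂ : ℕ} (a : List A) {r₁ : List (M₁.Γ M₁.k₁)}
    {r₂ : List (M₂.Γ M₂.k₁)}
    (h₁ : RunsIn (step M₁.m) n₁ (initList M₁ (a.map i₁)) (haltList M₁ r₁))
    (h₂ : RunsIn (step M₂.m) n₂ (initList M₂ (a.map i₂)) (haltList M₂ r₂)) :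
    RunsIn (step (catProg i₁ i₂ o₁ o₂))
      (2 * a.length + n₁ + n₂ + 2 * r₁.length + 2 * r₂.length + 6)
      ⟨some (.inr 0), ((M₁.initialState, M₂.initialState), none, none),
        catStk (fun _ => []) (fun _ => []) a [] [] []⟩
      ⟨none, ((M₁.initialState, M₂.initialState), none, none),
        catStk (fun _ => []) (fun _ => []) [] [] [] (r₁.map o₁ ++ r₂.map o₂)⟩ := by
  have s0 := runsIn_catProg_zero i₁ i₂ o₁ o₂ (M₁.initialState, M₂.initialState)
    (fun _ => []) (fun _ => []) a [] [] [] none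
  have s1 := runsIn_catProg_one i₁ i₂ o₁ o₂ (M₁.initialState, M₂.initialState)
    [] [] a.reverse [] [] none
  have s2 := runsIn_catProg_fst i₁ i₂ o₁ o₂ h₁ (M₂.initialState, none, none)
    (Function.update (fun _ => []) M₂.k₀ (a.map i₂)) [] [] [] []
  have s3 := runsIn_catProg_snd i₁ i₂ o₁ o₂ h₂ (M₁.initialState, none, none)
    (Function.update (fun _ => []) M₁.k₁ r₁) [] [] [] []
  have s4 := runsIn_catProg_two i₁ i₂ o₁ o₂ (M₁.initialState, M₂.initialState)
    (Function.update (fun _ => []) M₁.k₁ r₁) r₂ [] [] [] [] none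
  have s5 := runsIn_catProg_three i₁ i₂ o₁ o₂ (M₁.initialState, M₂.initialState)
    (Function.update (fun _ => []) M₁.k₁ r₁) (fun _ => []) [] [] (r₂.map o₂).reverse [] none
  have s6 := runsIn_catProg_four i₁ i₂ o₁ o₂ (M₁.initialState, M₂.initialState)
    (fun _ => []) r₁ [] [] [] (r₂.map o₂) none
  have s7 := runsIn_catProg_five i₁ i₂ o₁ o₂ (M₁.initialState, M₂.initialState)
    (fun _ => []) (fun _ => []) [] [] (r₁.map o₁).reverse (r₂.map o₂) none
  simp only [embFst, embSnd, initList_stk, haltList_stk] at s2 s3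
  simp only [Function.update_eq_self, List.append_nil, List.length_reverse, List.map_reverse,
    List.reverse_reverse, List.length_map] at s0 s1 s4 s5 s6 s7
  exact ((((((((s0.trans s1).trans s2).trans s3).trans s4).trans s5).trans s6).trans s7)).cast
    (by ring)

end Phases

/-- The machine that writes down the outputs of two given machines one after the other. -/
def catMachine [Fintype A] [Fintype B] (i₁ : A → M₁.Γ M₁.k₀) (i₂ : A → M₂.Γ M₂.k₀)
    (o₁ : M₁.Γ M₁.k₁ → B) (o₂ : M₂.Γ M₂.k₁ → B) : FinTM2 :=
  letI := M₁.kFin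
  letI := M₂.kFin
  letI := M₁.ΛFin
  letI := M₂.ΛFin
  letI := M₁.σFin
  letI := M₂.σFin
  { K := CatK M₁ M₂
    k₀ := .inr (.inl false)
    k₁ := .inr (.inr true)
    Γ := CatΓ M₁ M₂ A B
    Λ := CatΛ M₁ M₂
    main := .inr 0
    σ := Catσ M₁ M₂ A B
    initialState := ((M₁.initialState, M₂.initialState), none, none)
    Γk₀Fin := inferInstanceAs (Fintype A)
    m := catProg i₁ i₂ o₁ o₂ }

theorem polyTime_of_runsIn {α β A B : Type} {ea : α → List A} {e : β → List B} {f : α → β}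
    (M : FinTM2) (iA : M.Γ M.k₀ ≃ A) (iB : M.Γ M.k₁ ≃ B) (time : Polynomial ℕ)
    (h : ∀ a, ∃ n ≤ time.eval (ea a).length, RunsIn M.step n
      ⟨some M.main, M.initialState,
        Function.update (fun _ => []) M.k₀ ((ea a).map iA.symm)⟩
      ⟨none, M.initialState,
        Function.update (fun _ => []) M.k₁ ((e (f a)).map iB.symm)⟩) :
    Nonempty (TM2ComputableInPolyTime ea e f) := by
  choose n hn hr using h
  refine ⟨⟨⟨M, iA, iB⟩, time, fun a => ⟨⟨n a, ?_⟩, hn a⟩⟩⟩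
  have r := hr a
  rw [← initList_stk, ← haltList_stk] at r
  exact r.iterate

theorem length_initList_stk_le (M : FinTM2) (s : List (M.Γ M.k₀)) (k : M.K) :
    ((initList M s).stk k).length ≤ s.length := by
  rw [initList_stk]
  rcases eq_or_ne k M.k₀ with rfl | h
  · simp
  · simp [h]

/-- If `f₁` and `f₂` are computable in polynomial time, so is any function whose (encoded) value is
the concatenation of the relabelled values of `f₁` and `f₂`. -/
theorem polyTime_concat {α β₁ β₂ β B₁ B₂ : Type} [Fintype A] [Fintype B]
    {ea : α → List A} {e₁ : β₁ → List B₁} {e₂ : β₂ → List B₂} {e : β → List B}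
    {f₁ : α → β₁} {f₂ : α → β₂} {f : α → β}
    (h₁ : Nonempty (TM2ComputableInPolyTime ea e₁ f₁))
    (h₂ : Nonempty (TM2ComputableInPolyTime ea e₂ f₂)) (j₁ : B₁ → B) (j₂ : B₂ → B)
    (hf : ∀ a, e (f a) = (e₁ (f₁ a)).map j₁ ++ (e₂ (f₂ a)).map j₂) :
    Nonempty (TM2ComputableInPolyTime ea e f) := by
  obtain ⟨c₁⟩ := h₁
  obtain ⟨c₂⟩ := h₂
  let _ := c₁.tm.ΛFin
  let _ := c₂.tm.ΛFin
  let P₁ : ℕ := ∑ l, pushCount (c₁.tm.m l)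
  let P₂ : ℕ := ∑ l, pushCount (c₂.tm.m l)
  -- The input is moved twice and each output twice. An output of machine `i` has length at most
  -- input length plus `Pᵢ` times running time, whence `6 = 2 + 2 + 2` and the factors `1 + 2 * Pᵢ`.
  refine polyTime_of_runsIn (catMachine (A := A) (B := B) c₁.inputAlphabet.symm
    c₂.inputAlphabet.symm (j₁ ∘ c₁.outputAlphabet) (j₂ ∘ c₂.outputAlphabet)) (Equiv.refl _)
    (Equiv.refl _) (6 * Polynomial.X + (1 + 2 * Polynomial.C P₁) * c₁.time +
      (1 + 2 * Polynomial.C P₂) * c₂.time + 6) fun a => ?_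
  have r₁ := RunsIn.of_iterate (c₁.outputsFun a).evals_in_steps
  have r₂ := RunsIn.of_iterate (c₂.outputsFun a).evals_in_steps
  have l₁ := RunsIn.length_stk_le c₁.tm.m r₁ c₁.tm.k₁
  have l₂ := RunsIn.length_stk_le c₂.tm.m r₂ c₂.tm.k₁
  have t₁ := (c₁.outputsFun a).steps_le_m
  have t₂ := (c₂.outputsFun a).steps_le_m
  have r := runsIn_catProg (M₁ := c₁.tm) (M₂ := c₂.tm) c₁.inputAlphabet.symm
    c₂.inputAlphabet.symm (j₁ ∘ c₁.outputAlphabet) (j₂ ∘ c₂.outputAlphabet) (ea a) r₁ r₂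
  have b₁ : ((initList c₁.tm ((ea a).map c₁.inputAlphabet.symm)).stk c₁.tm.k₁).length ≤
      (ea a).length := length_initList_stk_le _ _ _ |>.trans (by simp)
  have b₂ : ((initList c₂.tm ((ea a).map c₂.inputAlphabet.symm)).stk c₂.tm.k₁).length ≤
      (ea a).length := length_initList_stk_le _ _ _ |>.trans (by simp)
  have m₁ : ((e₁ (f₁ a)).map c₁.outputAlphabet.invFun).map (j₁ ∘ c₁.outputAlphabet) =
      (e₁ (f₁ a)).map j₁ := by simp [List.map_map, Function.comp_def]
  have m₂ : ((e₂ (f₂ a)).map c₂.outputAlphabet.invFun).map (j₂ ∘ c₂.outputAlphabet) =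
      (e₂ (f₂ a)).map j₂ := by simp [List.map_map, Function.comp_def]
  rw [m₁, m₂, ← hf] at r
  have hA (l : List A) : l.map (Equiv.refl A).symm = l := List.map_id l
  have hB (l : List B) : l.map (Equiv.refl B).symm = l := List.map_id l
  have z₁ : catStk (M₁ := c₁.tm) (M₂ := c₂.tm) (fun _ => []) (fun _ => []) (ea a) []
      ([] : List B) [] = Function.update (β := fun k => List (CatΓ c₁.tm c₂.tm A B k))
        (fun _ => []) (.inr (.inl false)) ((ea a).map (Equiv.refl A).symm) := by
    rw [hA]
    funext k
    rcases k with (k | k) | (_ | _) | (_ | _) <;> rfl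
  have z₂ : catStk (M₁ := c₁.tm) (M₂ := c₂.tm) (fun _ => []) (fun _ => []) ([] : List A) []
      [] (e (f a)) = Function.update
        (β := fun k => List (CatΓ c₁.tm c₂.tm A B k)) (fun _ => []) (.inr (.inr true))
        ((e (f a)).map (Equiv.refl B).symm) := by
    rw [hB]
    funext k
    rcases k with (k | k) | (_ | _) | (_ | _) <;> rfl
  rw [z₁, z₂] at r
  have time_le {n p P L : ℕ} (h : L ≤ n + p * P) : 2 * L ≤ 2 * n + 2 * P * p := by
    rw [mul_comm] at h
    nlinarith
  have l₁' := time_le ((l₁.trans (Nat.add_le_add b₁ (Nat.mul_le_mul_right P₁ t₁))))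
  have l₂' := time_le ((l₂.trans (Nat.add_le_add b₂ (Nat.mul_le_mul_right P₂ t₂))))
  have le : 2 * (ea a).length + (c₁.outputsFun a).steps + (c₂.outputsFun a).steps +
      2 * ((e₁ (f₁ a)).map c₁.outputAlphabet.invFun).length +
      2 * ((e₂ (f₂ a)).map c₂.outputAlphabet.invFun).length + 6 ≤
      (6 * Polynomial.X + (1 + 2 * Polynomial.C P₁) * c₁.time +
      (1 + 2 * Polynomial.C P₂) * c₂.time + 6).eval (ea a).length := by
    simp only [haltList_stk, Function.update_self] at l₁' l₂'
    simp only [Polynomial.eval_add, Polynomial.eval_mul, Polynomial.eval_X, Polynomial.eval_C,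
      Polynomial.eval_ofNat, add_mul, one_mul]
    omega
  refine ⟨_, le, ?_⟩
  exact r

end Concat

/-! ### A Turing machine for layers of single-qubit gates -/

/-- The circuit applying the gate `g` to the pairs `(i, i + 1)`, `a ≤ i < a + b`, the last pair
first. -/
def ladder {r : ℕ} (g : Fin r) : ℕ → ℕ → Circuit r
  | _, 0 => []
  | a, b + 1 => ladder g (a + 1) b ++ [(g, a, a + 1)]

/-- The counter following a given one; the last counter collects all further parameters. -/
def nextCounter : Fin 4 → Fin 4 := ![1, 2, 3, 3]

/-- Adding a list of numbers to consecutive counters. -/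
def readParams : Fin 4 → List ℕ → (Fin 4 → ℕ) → Fin 4 → ℕ
  | _, [], S => S
  | j, a :: l, S => readParams (nextCounter j) l (Function.update S j (S j + a))

/-- On genuine parameters the fourth counter stays zero, so it serves as the constant 0 when a layer
starts at qubit 0. -/
theorem readParams_triple (n m κ : ℕ) : readParams 0 [n, m, κ] 0 = ![n, m, κ, 0] := by
  funext i
  fin_cases i <;> simp [readParams, nextCounter]

theorem sum_update_add {ι : Type*} [Fintype ι] [DecidableEq ι] (S : ι → ℕ) (j : ι) (a : ℕ) :
    ∑ i, Function.update S j (S j + a) i = ∑ i, S i + a := by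
  rw [Finset.sum_update_of_mem (Finset.mem_univ j), add_right_comm,
    ← Finset.sum_update_of_mem (Finset.mem_univ j), Function.update_eq_self]

theorem sum_readParams_le (j : Fin 4) (l : List ℕ) (S : Fin 4 → ℕ) :
    ∑ i, readParams j l S i ≤ ∑ i, S i + (encodeParams l).length := by
  induction l generalizing j S with
  | nil => simp [readParams]
  | cons a l ih =>
    refine (ih _ _).trans ?_
    rw [sum_update_add]
    simp [encodeParams]
    omega

section Ladder

open Turing Turing.TM2

/-- Stacks of the ladder machine: four counters, the input, an auxiliary counter, the output. -/
abbrev LadderK : Type := Fin 4 ⊕ Option Bool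

/-- Stack alphabets of the ladder machine. -/
abbrev LadderΓ (r : ℕ) : LadderK → Type
  | .inl _ => Unit
  | .inr (some false) => Bool
  | .inr (some true) => Unit
  | .inr none => Fin r ⊕ Bool

variable {r : ℕ}

/-- The stacks of the ladder machine. -/
def ladderStk (S : Fin 4 → ℕ) (i : List Bool) (y : ℕ) (o : List (Fin r ⊕ Bool)) :
    ∀ k, List (LadderΓ r k)
  | .inl j => List.replicate (S j) ()
  | .inr (some false) => i
  | .inr (some true) => List.replicate y ()
  | .inr none => o

section Update

variable (S : Fin 4 → ℕ) (i : List Bool) (y : ℕ) (o : List (Fin r ⊕ Bool))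

@[simp] theorem ladderStk_counter (j : Fin 4) :
    ladderStk S i y o (.inl j) = List.replicate (S j) () := rfl
@[simp] theorem ladderStk_inp : ladderStk S i y o (.inr (some false)) = i := rfl
@[simp] theorem ladderStk_aux :
    ladderStk S i y o (.inr (some true)) = List.replicate y () := rfl
@[simp] theorem ladderStk_out : ladderStk S i y o (.inr none) = o := rfl

@[simp] theorem update_ladderStk_counter (j : Fin 4) (x : List (LadderΓ r (.inl j))) :
    Function.update (ladderStk S i y o) (.inl j) x =
      ladderStk (Function.update S j x.length) i y o := by
  funext l
  rcases l with l | _ | _ | _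
  · rcases eq_or_ne l j with rfl | h
    · simp [List.eq_replicate_iff]
    · simp [h]
  all_goals rfl

@[simp] theorem update_ladderStk_inp (x : List Bool) :
    Function.update (ladderStk S i y o) (.inr (some false)) x = ladderStk S x y o := by
  funext l
  rcases l with l | _ | _ | _ <;> rfl

@[simp] theorem update_ladderStk_aux (x : List (LadderΓ r (.inr (some true)))) :
    Function.update (ladderStk S i y o) (.inr (some true)) x = ladderStk S i x.length o := by
  funext l
  rcases l with l | _ | _ | _
  case inr.some.true => simp [List.eq_replicate_iff]
  all_goals rfl

@[simp] theorem update_ladderStk_out (x : List (Fin r ⊕ Bool)) :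
    Function.update (ladderStk S i y o) (.inr none) x = ladderStk S i y x := by
  funext l
  rcases l with l | _ | _ | _ <;> rfl

end Update

/-- Program of the ladder machine. It reads the parameters into the counters, then writes the
instructions `(g, i, i + 1)`, where `i` starts at counter `x` and counter `b` is the number of
instructions, and finally clears the counters. -/
def ladderProg (g : Fin r) (x b : Fin 4) :
    Fin 4 ⊕ Fin 4 → Stmt (LadderΓ r) (Fin 4 ⊕ Fin 4) (Option Bool)
  | .inl j => .pop (.inr (some false)) (fun _ c => c) <|
      .branch (fun v => v.isSome)
        (.branch (fun v => v.getD false)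
          (.push (.inl j) (fun _ => ()) <| .goto fun _ => .inl j)
          (.goto fun _ => .inl (nextCounter j)))
        (.goto fun _ => .inr 0)
  -- An instruction is written from its end: the final 0, then the extra 1 that turns `i` into `i +
  -- 1`. Moving counter `x` to the auxiliary stack and back writes `1ⁱ` twice, and the return trip
  -- leaves `x` increased by one.
  | .inr 0 => .pop (.inl b) (fun _ c => c.map fun _ => true) <|
      .branch (fun v => v.isSome)
        (.push (.inr none) (fun _ => .inr false) <| .push (.inr none) (fun _ => .inr true) <|
          .goto fun _ => .inr 1)
        (.goto fun _ => .inr 3)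
  | .inr 1 => .pop (.inl x) (fun _ c => c.map fun _ => true) <|
      .branch (fun v => v.isSome)
        (.push (.inr (some true)) (fun _ => ()) <| .push (.inr none) (fun _ => .inr true) <|
          .goto fun _ => .inr 1)
        (.push (.inr none) (fun _ => .inr false) <| .goto fun _ => .inr 2)
  | .inr 2 => .pop (.inr (some true)) (fun _ c => c.map fun _ => true) <|
      .branch (fun v => v.isSome)
        (.push (.inl x) (fun _ => ()) <| .push (.inr none) (fun _ => .inr true) <|
          .goto fun _ => .inr 2)
        (.push (.inl x) (fun _ => ()) <| .push (.inr none) (fun _ => .inl g) <|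
          .goto fun _ => .inr 0)
  -- All counters are decremented together; the internal state records whether any pop succeeded,
  -- and the machine halts after a round in which none did.
  | .inr 3 => .load (fun _ => none) <|
      .pop (.inl 0) (fun v c => if c.isSome then some true else v) <|
      .pop (.inl 1) (fun v c => if c.isSome then some true else v) <|
      .pop (.inl 2) (fun v c => if c.isSome then some true else v) <|
      .pop (.inl 3) (fun v c => if c.isSome then some true else v) <|
      .branch (fun v => v.isSome) (.goto fun _ => .inr 3) .halt

variable (g : Fin r) (x b : Fin 4)

theorem runsIn_ladderProg_ones (j : Fin 4) (a : ℕ) (l : List Bool) (S : Fin 4 → ℕ) (y : ℕ)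
    (o : List (Fin r ⊕ Bool)) (v : Option Bool) :
    RunsIn (step (ladderProg g x b)) (a + 1)
      ⟨some (.inl j), v, ladderStk S (List.replicate a true ++ false :: l) y o⟩
      ⟨some (.inl (nextCounter j)), some false,
        ladderStk (Function.update S j (S j + a)) l y o⟩ := by
  induction a generalizing S v with
  | zero => exact .single (by simp [ladderProg])
  | succ a ih =>
    refine .head (b := ⟨some (.inl j), some true, ladderStk (Function.update S j (S j + 1))
      (List.replicate a true ++ false :: l) y o⟩) ?_ ?_
    · simp [ladderProg, List.replicate_succ]
    · simpa [add_assoc, add_comm 1 a] using ih (Function.update S j (S j + 1)) (some true)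

theorem runsIn_ladderProg_read (j : Fin 4) (l : List ℕ) (S : Fin 4 → ℕ) (y : ℕ)
    (o : List (Fin r ⊕ Bool)) (v : Option Bool) :
    RunsIn (step (ladderProg g x b)) ((encodeParams l).length + 1)
      ⟨some (.inl j), v, ladderStk S (encodeParams l) y o⟩
      ⟨some (.inr 0), none, ladderStk (readParams j l S) [] y o⟩ := by
  induction l generalizing S v j with
  | nil => exact .single (by simp [ladderProg, encodeParams, readParams])
  | cons a l ih =>
    have h := (runsIn_ladderProg_ones g x b j a (encodeParams l) S y o v).trans
      (ih (nextCounter j) (Function.update S j (S j + a)) (some false))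
    have e : encodeParams (a :: l) = List.replicate a true ++ false :: encodeParams l := by
      simp [encodeParams]
    rw [e]
    exact h.cast (by simp; omega)

theorem runsIn_ladderProg_snd (S : Fin 4 → ℕ) (a : ℕ) (ha : S x = a) (i : List Bool) (y : ℕ)
    (o : List (Fin r ⊕ Bool)) (v : Option Bool) :
    RunsIn (step (ladderProg g x b)) (a + 1)
      ⟨some (.inr 1), v, ladderStk S i y o⟩
      ⟨some (.inr 2), none, ladderStk (Function.update S x 0) i (y + a)
        (.inr false :: (List.replicate a (.inr true) ++ o))⟩ := by
  induction a generalizing S v y o with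
  | zero => exact .single (by simp [ladderProg, ha])
  | succ a ih =>
    refine .head (b := ⟨some (.inr 1), some true, ladderStk (Function.update S x a) i (y + 1)
      (.inr true :: o)⟩) ?_ ?_
    · simp [ladderProg, ha, List.replicate_succ]
    · have h := ih (Function.update S x a) (by simp) (y + 1) (.inr true :: o) (some true)
      rw [Function.update_idem, add_assoc, add_comm 1 a] at h
      rw [List.replicate_succ', List.append_assoc]
      exact h

theorem runsIn_ladderProg_fst (S : Fin 4 → ℕ) (i : List Bool) (y : ℕ)
    (o : List (Fin r ⊕ Bool)) (v : Option Bool) :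
    RunsIn (step (ladderProg g x b)) (y + 1)
      ⟨some (.inr 2), v, ladderStk S i y o⟩
      ⟨some (.inr 0), none, ladderStk (Function.update S x (S x + y + 1)) i 0
        (.inl g :: (List.replicate y (.inr true) ++ o))⟩ := by
  induction y generalizing S v o with
  | zero => exact .single (by simp [ladderProg])
  | succ y ih =>
    refine .head (b := ⟨some (.inr 2), some true, ladderStk (Function.update S x (S x + 1)) i y
      (.inr true :: o)⟩) ?_ ?_
    · simp [ladderProg, List.replicate_succ]
    · have h := ih (Function.update S x (S x + 1)) (.inr true :: o) (some true)
      rw [Function.update_idem, Function.update_self, add_assoc (S x), add_comm 1 y] at h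
      rw [List.replicate_succ', List.append_assoc]
      exact h

/-- The output is a stack, so what is written first is read last: the instruction at the initial
index ends up at the end of the circuit. This is why `ladder` appends it. -/
theorem runsIn_ladderProg_loop (hxb : x ≠ b) (S : Fin 4 → ℕ) (c : ℕ) (hc : S b = c)
    (i : List Bool) (o : List (Fin r ⊕ Bool)) (v : Option Bool) :
    ∃ n ≤ c * (2 * (S x + c) + 3) + 1, RunsIn (step (ladderProg g x b)) n
      ⟨some (.inr 0), v, ladderStk S i 0 o⟩
      ⟨some (.inr 3), none, ladderStk (Function.update (Function.update S b 0) x (S x + c)) i 0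
        (encodeCircuit (ladder g (S x) c) ++ o)⟩ := by
  induction c generalizing S o v with
  | zero =>
    refine ⟨1, by simp, .single ?_⟩
    have h : Function.update S b 0 = S := by rw [← hc, Function.update_eq_self]
    simp [ladderProg, hc, h, ladder, encodeCircuit]
  | succ c ih =>
    have h0 : RunsIn (step (ladderProg g x b)) 1 ⟨some (.inr 0), v, ladderStk S i 0 o⟩
        ⟨some (.inr 1), some true, ladderStk (Function.update S b c) i 0
          (.inr true :: .inr false :: o)⟩ :=
      .single (by simp [ladderProg, hc, List.replicate_succ])
    have h1 := runsIn_ladderProg_snd g x b (Function.update S b c) (S x) (by simp [hxb]) i 0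
      (.inr true :: .inr false :: o) (some true)
    have h2 := runsIn_ladderProg_fst g x b (Function.update (Function.update S b c) x 0) i
      (0 + S x) (.inr false :: (List.replicate (S x) (.inr true) ++
        .inr true :: .inr false :: o)) none
    obtain ⟨n, hn, h3⟩ := ih (Function.update (Function.update S b c) x (S x + 1))
      (by simp [hxb.symm]) (encodeCircuit [(g, S x, S x + 1)] ++ o) none
    refine ⟨1 + (S x + 1) + (S x + 1) + n, ?_, ?_⟩
    · simp only [Function.update_self] at hn
      nlinarith
    · simp only [Function.update_self, zero_add, Function.update_idem] at h1 h2 h3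
      have e1 : (Sum.inl g :: (List.replicate (S x) (Sum.inr true) ++ Sum.inr false ::
          (List.replicate (S x) (Sum.inr true) ++ Sum.inr true :: Sum.inr false :: o)) :
          List (Fin r ⊕ Bool)) = encodeCircuit [(g, S x, S x + 1)] ++ o := by
        simp [encodeCircuit, List.replicate_succ']
      have e2 : encodeCircuit (ladder g (S x) (c + 1)) ++ o =
          encodeCircuit (ladder g (S x + 1) c) ++ (encodeCircuit [(g, S x, S x + 1)] ++ o) := by
        simp [ladder, encodeCircuit]
      have e3 : Function.update (Function.update (Function.update (Function.update S b c) x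
          (S x + 1)) b 0) x (S x + 1 + c) =
          Function.update (Function.update S b 0) x (S x + (c + 1)) := by
        rw [Function.update_comm hxb, Function.update_idem, Function.update_idem,
          add_assoc, add_comm 1 c]
      rw [e1] at h2
      rw [e3] at h3
      rw [e2]
      exact ((h0.trans h1).trans h2).trans h3

theorem runsIn_ladderProg_clear (S : Fin 4 → ℕ) (t : ℕ) (ht : ∑ j, S j ≤ t) (i : List Bool)
    (y : ℕ) (o : List (Fin r ⊕ Bool)) (v : Option Bool) :
    ∃ n ≤ t + 1, RunsIn (step (ladderProg g x b)) n
      ⟨some (.inr 3), v, ladderStk S i y o⟩ ⟨none, none, ladderStk 0 i y o⟩ := by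
  induction t generalizing S v with
  | zero =>
    have hS : S = 0 := by
      funext j
      simpa using (Finset.sum_eq_zero_iff.1 (Nat.le_zero.1 ht)) j (Finset.mem_univ j)
    subst hS
    refine ⟨1, le_rfl, .single ?_⟩
    simp [ladderProg]
  | succ t ih =>
    have hd : Function.update (Function.update (Function.update (Function.update S 0 (S 0 - 1)) 1
        (S 1 - 1)) 2 (S 2 - 1)) 3 (S 3 - 1) = fun j => S j - 1 := by
      funext j
      fin_cases j <;> simp
    by_cases hS : S = 0
    · subst hS
      refine ⟨1, by omega, .single ?_⟩
      simp [ladderProg]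
    · have hle : ∑ j, (S j - 1) ≤ t := by
        obtain ⟨j, hj⟩ := Function.ne_iff.1 hS
        have : ∑ j, (S j - 1) < ∑ j, S j :=
          Finset.sum_lt_sum (fun _ _ => Nat.sub_le _ _)
            ⟨j, Finset.mem_univ j, Nat.sub_lt (Nat.pos_of_ne_zero hj) one_pos⟩
        omega
      have hs : ∃ v', step (ladderProg g x b) ⟨some (.inr 3), v, ladderStk S i y o⟩ =
          some ⟨some (.inr 3), v', ladderStk (fun j => S j - 1) i y o⟩ := by
        have hne : S 0 ≠ 0 ∨ S 1 ≠ 0 ∨ S 2 ≠ 0 ∨ S 3 ≠ 0 := by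
          by_contra hcon
          push Not at hcon
          refine hS (funext fun j => ?_)
          fin_cases j
          exacts [hcon.1, hcon.2.1, hcon.2.2.1, hcon.2.2.2]
        refine ⟨some true, ?_⟩
        rw [← hd]
        rcases h0 : S 0 with _ | a0 <;> rcases h1 : S 1 with _ | a1 <;>
          rcases h2 : S 2 with _ | a2 <;> rcases h3 : S 3 with _ | a3 <;>
          simp_all [ladderProg, List.replicate_succ]
      obtain ⟨v', hs⟩ := hs
      obtain ⟨n, hn, h⟩ := ih _ hle v'
      exact ⟨n + 1, by omega, .head hs h⟩

/-- The machine writing down the circuit `ladder g (S x) (S b)`, with `S` the parameters. -/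
def ladderMachine : FinTM2 where
  K := LadderK
  k₀ := .inr (some false)
  k₁ := .inr none
  Γ := LadderΓ r
  Λ := Fin 4 ⊕ Fin 4
  main := .inl 0
  σ := Option Bool
  initialState := none
  Γk₀Fin := inferInstanceAs (Fintype Bool)
  m := ladderProg g x b

/-- With input length `L` there are at most `L` instructions, each with unary indices of size
O(`L`); reading and clearing are linear. Hence a quadratic bound. -/
theorem polyTime_ladder (hxb : x ≠ b) :
    Nonempty (TM2ComputableInPolyTime encodeParams encodeCircuit fun l =>
      ladder g (readParams 0 l 0 x) (readParams 0 l 0 b)) := by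
  refine polyTime_of_runsIn (ladderMachine g x b) (Equiv.refl _) (Equiv.refl _)
    (10 * (Polynomial.X + 1) ^ 2) fun l => ?_
  set S := readParams 0 l 0 with hS
  set L := (encodeParams l).length with hL
  have hsum : ∑ j, S j ≤ L := by simpa using sum_readParams_le 0 l 0
  -- Distinct counters share the input symbols, so the running index, which ends at `S x + S b`,
  -- never exceeds `L`.
  have hxb_le : S x + S b ≤ L := by
    refine le_trans ?_ hsum
    rw [← Finset.sum_pair hxb]
    exact Finset.sum_le_sum_of_subset (Finset.subset_univ _)
  have h1 := runsIn_ladderProg_read g x b 0 l 0 0 [] none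
  rw [← hS, ← hL] at h1
  obtain ⟨n2, hn2, h2⟩ := runsIn_ladderProg_loop g x b hxb S _ rfl [] [] none
  have hsum' : ∑ j, Function.update (Function.update S b 0) x (S x + S b) j ≤ L := by
    refine le_trans (le_of_eq ?_) hsum
    have e1 := sum_update_add (Function.update S b 0) x (S b)
    have e2 := sum_update_add (Function.update S b 0) b (S b)
    rw [Function.update_of_ne hxb] at e1
    rw [Function.update_self, Function.update_idem, zero_add, Function.update_eq_self] at e2
    rw [e1, e2]
  obtain ⟨n3, hn3, h3⟩ := runsIn_ladderProg_clear g x b _ L hsum' [] 0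
    (encodeCircuit (ladder g (S x) (S b)) ++ []) none
  rw [List.append_nil] at h2 h3
  have z₁ : ladderStk (r := r) 0 (encodeParams l) 0 [] =
      Function.update (β := fun k => List (LadderΓ r k)) (fun _ => []) (.inr (some false))
        ((encodeParams l).map (Equiv.refl Bool).symm) := by
    funext k
    rcases k with k | _ | _ | _
    case inr.some.false => exact (List.map_id _).symm
    all_goals rfl
  have z₂ : ladderStk (r := r) 0 [] 0 (encodeCircuit (ladder g (S x) (S b))) =
      Function.update (β := fun k => List (LadderΓ r k)) (fun _ => []) (.inr none)
        ((encodeCircuit (ladder g (S x) (S b))).map (Equiv.refl _).symm) := by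
    funext k
    rcases k with k | _ | _ | _
    case inr.none => exact (List.map_id _).symm
    all_goals rfl
  rw [z₁] at h1
  rw [z₂] at h3
  have le : L + 1 + n2 + n3 ≤ (10 * (Polynomial.X + 1) ^ 2 : Polynomial ℕ).eval L := by
    simp only [Polynomial.eval_mul, Polynomial.eval_ofNat, Polynomial.eval_pow,
      Polynomial.eval_add, Polynomial.eval_X, Polynomial.eval_one]
    have : S b * (2 * (S x + S b) + 3) ≤ L * (2 * L + 3) :=
      Nat.mul_le_mul (by omega) (by omega)
    nlinarith
  exact ⟨_, le, (h1.trans h2).trans h3⟩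

end Ladder

/-! ### Linearity and composition of efficient maps -/

theorem Gate.apply_add (G : Gate) (i j : ℕ) (X Y : Register) :
    G.apply i j (X + Y) = G.apply i j X + G.apply i j Y := by
  unfold Gate.apply
  split_ifs
  · rfl
  · funext x y
    simp only [Pi.add_apply, mul_add, add_mul, Finset.sum_add_distrib]

theorem Gate.apply_smul (G : Gate) (i j : ℕ) (c : ℂ) (X : Register) :
    G.apply i j (c • X) = c • G.apply i j X := by
  unfold Gate.apply
  split_ifs
  · rfl
  · funext x y
    simp only [Pi.smul_apply, smul_eq_mul, Finset.mul_sum]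
    refine Finset.sum_congr rfl fun _ _ => Finset.sum_congr rfl fun _ _ =>
      Finset.sum_congr rfl fun _ _ => ?_
    ring

theorem run_append {r : ℕ} (lib : Fin r → Gate) (C D : Circuit r) (X : Register) :
    run lib (C ++ D) X = run lib D (run lib C X) := List.foldl_append

theorem run_add {r : ℕ} (lib : Fin r → Gate) (C : Circuit r) (X Y : Register) :
    run lib C (X + Y) = run lib C X + run lib C Y := by
  induction C generalizing X Y with
  | nil => rfl
  | cons g C ih =>
    change run lib C ((lib g.1).apply g.2.1 g.2.2 (X + Y)) = _
    rw [Gate.apply_add, ih]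
    rfl

theorem run_smul {r : ℕ} (lib : Fin r → Gate) (C : Circuit r) (c : ℂ) (X : Register) :
    run lib C (c • X) = c • run lib C X := by
  induction C generalizing X with
  | nil => rfl
  | cons g C ih =>
    change run lib C ((lib g.1).apply g.2.1 g.2.2 (c • X)) = _
    rw [Gate.apply_smul, ih]
    rfl

theorem run_map {r s : ℕ} (lib : Fin s → Gate) (f : Fin r → Fin s) (C : Circuit r)
    (X : Register) :
    run lib (C.map fun g => (f g.1, g.2)) X = run (fun g => lib (f g)) C X := by
  unfold run
  rw [List.foldl_map]

theorem load_add {N : ℕ} (ρ σ : Op N) : load (ρ + σ) = load ρ + load σ := by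
  funext x y
  simp only [load, Pi.add_apply, Matrix.add_apply]
  split_ifs <;> simp

theorem load_smul {N : ℕ} (c : ℂ) (ρ : Op N) : load (c • ρ) = c • load ρ := by
  funext x y
  simp only [load, Pi.smul_apply, Matrix.smul_apply]
  split_ifs <;> simp

/-- Extending a bit string by zeros. -/
def extendBits {N : ℕ} (a : Bits N) : ℕ → Bool := fun i => if h : i < N then a ⟨i, h⟩ else false

theorem load_extendBits {N : ℕ} (ρ : Op N) (a b : Bits N) :
    load ρ (extendBits a) (extendBits b) = ρ a b := by
  have h : ∀ i, N ≤ i → extendBits a i = false ∧ extendBits b i = false := fun i hi => by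
    simp [extendBits, hi.not_gt]
  rw [load, if_pos h]
  simp [extendBits]

theorem load_injective {N : ℕ} : Function.Injective (load : Op N → Register) := by
  intro ρ σ h
  ext a b
  rw [← load_extendBits ρ, h, load_extendBits]

/-- Linearity is not part of the definition of efficiency; it is inherited from the gates because
`load` is linear and injective. It allows averages over keys and over Haar states to be moved
through the algorithm. -/
theorem Efficient.exists_linear {pp : ℕ → List ℕ} {N M : ℕ → ℕ} {Φ : ∀ n, Op (N n) → Op (M n)}
    (h : Efficient pp N M Φ) :
    ∃ L : ∀ n, Op (N n) →ₗ[ℂ] Op (M n), ∀ n ρ, Φ n ρ = L n ρ := by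
  obtain ⟨r, lib, C, -, hC⟩ := h
  refine ⟨fun n => ⟨⟨Φ n, fun ρ σ => load_injective ?_⟩, fun c ρ => load_injective ?_⟩,
    fun n ρ => rfl⟩
  · rw [load_add, ← hC, ← hC, ← hC, load_add, run_add]
  · rw [RingHom.id_apply, load_smul, ← hC, ← hC, load_smul, run_smul]

theorem encodeCircuit_map {r s : ℕ} (f : Fin r → Fin s) (C : Circuit r) :
    encodeCircuit (C.map fun g => (f g.1, g.2)) = (encodeCircuit C).map (Sum.map f id) := by
  induction C with
  | nil => rfl
  | cons g C ih =>
    simp only [encodeCircuit, List.map_cons, List.flatMap_cons, List.map_append] at ih ⊢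
    rw [ih]
    simp

theorem encodeCircuit_append {r : ℕ} (C D : Circuit r) :
    encodeCircuit (C ++ D) = encodeCircuit C ++ encodeCircuit D := List.flatMap_append

/-- An efficient map leaves all non-output qubits in $|0\rangle$, so its final register is a legal
input for the next circuit. The circuits are concatenated over the disjoint union of the gate sets.
-/
theorem Efficient.comp {pp : ℕ → List ℕ} {N M L : ℕ → ℕ} {Φ : ∀ n, Op (N n) → Op (M n)}
    {Ψ : ∀ n, Op (M n) → Op (L n)} (hΨ : Efficient pp M L Ψ) (hΦ : Efficient pp N M Φ) :
    Efficient pp N L fun n ρ => Ψ n (Φ n ρ) := by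
  obtain ⟨r, libΦ, C, hC, hrunC⟩ := hΦ
  obtain ⟨s, libΨ, D, hD, hrunD⟩ := hΨ
  let _ : Inhabited (Fin (r + s) ⊕ Bool) := ⟨.inr false⟩
  refine ⟨r + s, Fin.append libΦ libΨ, fun l => ((C l).map fun g => (Fin.castAdd s g.1, g.2)) ++
    (D l).map fun g => (Fin.natAdd r g.1, g.2), ?_, fun n ρ => ?_⟩
  · refine polyTime_concat hC hD (Sum.map (Fin.castAdd s) id) (Sum.map (Fin.natAdd r) id)
      fun l => ?_
    rw [encodeCircuit_append, encodeCircuit_map, encodeCircuit_map]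
  · rw [run_append, run_map, run_map]
    simp only [Fin.append_left, Fin.append_right]
    rw [hrunC, hrunD]

/-! ### Layers of single-qubit gates -/

/-- The two-qubit gate acting by the given Kraus operators on its first qubit only. -/
def oneQubitGate {k : ℕ} (K : Fin k → Matrix Bool Bool ℂ) (hK : ∑ a, (K a)ᴴ * K a = 1) :
    Gate where
  rank := k
  kraus a := Matrix.of fun x u => K a x.1 u.1 * (1 : Matrix Bool Bool ℂ) x.2 u.2
  complete := by
    ext ⟨x, x'⟩ ⟨y, y'⟩
    have h := congrFun (congrFun hK x) y
    simp only [Matrix.sum_apply, Matrix.mul_apply, Matrix.conjTranspose_apply,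
      Matrix.of_apply, Fintype.sum_prod_type, Fintype.sum_bool] at h ⊢
    have e : (1 : Matrix (Bool × Bool) (Bool × Bool) ℂ) (x, x') (y, y') =
        (1 : Matrix Bool Bool ℂ) x y * (1 : Matrix Bool Bool ℂ) x' y' := by
      simp only [Matrix.one_apply, Prod.mk.injEq]
      split_ifs <;> simp_all
    rw [e, ← h]
    cases x' <;> cases y' <;> simp

/-- The kernel of the channel with the given Kraus operators. -/
def krausKernel {k : ℕ} (K : Fin k → Matrix Bool Bool ℂ) (x y u v : Bool) : ℂ :=
  ∑ a, K a x u * star (K a y v)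

/-- The second qubit is an idle partner, present only because gates are two-qubit and an instruction
with `i = j` is void. -/
theorem oneQubitGate_apply {k : ℕ} (K : Fin k → Matrix Bool Bool ℂ)
    (hK : ∑ a, (K a)ᴴ * K a = 1) {i j : ℕ} (hij : i ≠ j) (X : Register) (x y : ℕ → Bool) :
    (oneQubitGate K hK).apply i j X x y = ∑ u, ∑ v, krausKernel K (x i) (y i) u v *
      X (Function.update x i u) (Function.update y i v) := by
  have hset : ∀ (x : ℕ → Bool) u, setPair x i j (u, x j) = Function.update x i u := fun x u => by
    funext l
    rcases eq_or_ne l j with rfl | hl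
    · simp [setPair, hij.symm]
    · simp [setPair, hl]
  unfold Gate.apply
  rw [if_neg hij]
  simp only [krausKernel, oneQubitGate, Matrix.of_apply, Fintype.sum_prod_type,
    Matrix.one_apply, ← hset]
  generalize x j = p
  generalize y j = q
  simp only [Finset.sum_mul, Fintype.sum_bool, ← Finset.sum_add_distrib]
  refine Finset.sum_congr rfl fun a _ => ?_
  cases p <;> cases q <;> simp <;> ring

/-- Replacing the bits `a, …, a + b - 1`. -/
def setBits {b : ℕ} (x : ℕ → Bool) (a : ℕ) (u : Bits b) : ℕ → Bool := fun i =>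
  if h : a ≤ i ∧ i < a + b then u ⟨i - a, by omega⟩ else x i

theorem setBits_zero (x : ℕ → Bool) (a : ℕ) (u : Bits 0) : setBits x a u = x := by
  funext i
  simp only [setBits]
  rw [dif_neg (by omega)]

theorem setBits_cons {b : ℕ} (x : ℕ → Bool) (a : ℕ) (c : Bool) (u : Bits b) :
    setBits (b := b + 1) x a (Fin.cons c u) = setBits (Function.update x a c) (a + 1) u := by
  funext i
  simp only [setBits]
  rcases lt_trichotomy i a with h | h | h
  · rw [dif_neg (by omega), dif_neg (by omega), Function.update_of_ne h.ne]
  · subst h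
    rw [dif_pos (by omega), dif_neg (by omega), Function.update_self]
    have : (⟨i - i, by omega⟩ : Fin (b + 1)) = 0 := by ext; simp
    rw [this, Fin.cons_zero]
  · by_cases h2 : i < a + (b + 1)
    · rw [dif_pos (by omega), dif_pos (by omega)]
      have : (⟨i - a, by omega⟩ : Fin (b + 1)) = Fin.succ ⟨i - (a + 1), by omega⟩ := by
        ext; simp; omega
      rw [this, Fin.cons_succ]
    · rw [dif_neg (by omega), dif_neg (by omega), Function.update_of_ne h.ne']

/-- The gate at `a` runs last and touches none of the bits read by the others, so peeling it off
splits one factor from the product kernel. -/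
theorem run_ladder {k : ℕ} (K : Fin k → Matrix Bool Bool ℂ) (hK : ∑ a, (K a)ᴴ * K a = 1)
    (a b : ℕ) (X : Register) (x y : ℕ → Bool) :
    run (fun _ : Fin 1 => oneQubitGate K hK) (ladder 0 a b) X x y =
      ∑ u : Bits b, ∑ v : Bits b, (∏ i : Fin b, krausKernel K (x (a + i)) (y (a + i)) (u i) (v i)) *
        X (setBits x a u) (setBits y a v) := by
  induction b generalizing a x y with
  | zero => simp [ladder, run, setBits_zero]
  | succ b ih =>
    have h := oneQubitGate_apply K hK (Nat.succ_ne_self a).symm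
      (run (fun _ : Fin 1 => oneQubitGate K hK) (ladder 0 (a + 1) b) X) x y
    rw [ladder, run_append]
    change (oneQubitGate K hK).apply a (a + 1) _ x y = _
    rw [h, ← (Fin.consEquiv fun _ => Bool).sum_comp, Fintype.sum_prod_type]
    refine Finset.sum_congr rfl fun c _ => ?_
    simp only [ih, Finset.mul_sum]
    rw [Finset.sum_comm]
    refine Finset.sum_congr rfl fun u _ => ?_
    rw [← (Fin.consEquiv fun _ => Bool).sum_comp, Fintype.sum_prod_type]
    refine Finset.sum_congr rfl fun d _ => Finset.sum_congr rfl fun v _ => ?_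
    simp only [Fin.consEquiv, Equiv.coe_fn_mk, Fin.prod_univ_succ, Fin.cons_zero, Fin.cons_succ,
      setBits_cons, Fin.val_zero, add_zero, Fin.val_succ, mul_assoc]
    congr 2
    refine Finset.prod_congr rfl fun i _ => ?_
    rw [Function.update_of_ne (by omega), Function.update_of_ne (by omega), add_assoc,
      add_comm 1 (i : ℕ)]

/-! ### Efficient implementations of the channels of the construction -/

theorem efficient_ladder {k : ℕ} (K : Fin k → Matrix Bool Bool ℂ) (hK : ∑ a, (K a)ᴴ * K a = 1)
    {m κ N M : ℕ → ℕ} {Φ : ∀ n, Op (N n) → Op (M n)} {x b : Fin 4} (hxb : x ≠ b)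
    (h : ∀ n (ρ : Op (N n)), run (fun _ : Fin 1 => oneQubitGate K hK)
      (ladder 0 ((![n, m n, κ n, 0] : Fin 4 → ℕ) x) ((![n, m n, κ n, 0] : Fin 4 → ℕ) b))
        (load ρ) = load (Φ n ρ)) :
    Efficient (params m κ) N M Φ := by
  refine ⟨1, fun _ => oneQubitGate K hK,
    fun l => ladder 0 (readParams 0 l 0 x) (readParams 0 l 0 b), polyTime_ladder 0 x b hxb,
    fun n ρ => ?_⟩
  have e := readParams_triple (n) (m n) (κ n)
  simpa only [params, e] using h n ρ

theorem load_setBits_zero {n : ℕ} (ρ : Op n) (x y : ℕ → Bool) (u v : Bits n) :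
    load ρ (setBits x 0 u) (setBits y 0 v) =
      open Classical in if ∀ i, n ≤ i → x i = false ∧ y i = false then ρ u v else 0 := by
  classical
  have h1 : ∀ (x : ℕ → Bool) (u : Bits n), (fun i : Fin n => setBits x 0 u i) = u := by
    intro x u
    funext i
    simp [setBits]
  have h2 : ∀ (x : ℕ → Bool) (u : Bits n) i, n ≤ i → setBits x 0 u i = x i := by
    intro x u i hi
    simp only [setBits]
    rw [dif_neg (by omega)]
  rw [load, h1, h1]
  refine if_congr (forall_congr' fun i => forall_congr' fun hi => ?_) rfl rfl
  rw [h2 x u i hi, h2 y v i hi]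

theorem load_setBits {n m : ℕ} (ρ : Op (n + m)) (x y : ℕ → Bool) (u v : Bits m) :
    load ρ (setBits x n u) (setBits y n v) =
      open Classical in if ∀ i, n + m ≤ i → x i = false ∧ y i = false then
        ρ (Fin.append (fun i => x i) u) (Fin.append (fun i => y i) v) else 0 := by
  classical
  have h1 : ∀ (x : ℕ → Bool) (u : Bits m),
      (fun i : Fin (n + m) => setBits x n u i) = Fin.append (fun i => x i) u := by
    intro x u
    funext i
    refine Fin.addCases (fun j => ?_) (fun j => ?_) i
    · rw [Fin.append_left, setBits, dif_neg (by simp)]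
      rfl
    · rw [Fin.append_right, setBits, dif_pos (by simp)]
      congr
      simp
  have h2 : ∀ (x : ℕ → Bool) (u : Bits m) i, n + m ≤ i → setBits x n u i = x i := by
    intro x u i hi
    simp only [setBits]
    rw [dif_neg (by omega)]
  rw [load, h1, h1]
  refine if_congr (forall_congr' fun i => forall_congr' fun hi => ?_) rfl rfl
  rw [h2 x u i hi, h2 y v i hi]

/-! #### Tracing out qubits -/

/-- Kraus operators of the reset to `|0⟩`. -/
def resetKraus : Fin 2 → Matrix Bool Bool ℂ :=
  ![Matrix.single false false 1, Matrix.single false true 1]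

theorem resetKraus_complete : ∑ a, (resetKraus a)ᴴ * resetKraus a = 1 := by
  ext x y
  cases x <;> cases y <;> simp [resetKraus, Fin.sum_univ_two]

theorem krausKernel_resetKraus (x y u v : Bool) :
    krausKernel resetKraus x y u v = if x = false ∧ y = false ∧ u = v then 1 else 0 := by
  cases x <;> cases y <;> cases u <;> cases v <;>
    simp [krausKernel, resetKraus, Fin.sum_univ_two]

/-- Resetting a qubit means tracing it out and preparing $|0\rangle$, which is exactly how `load`
pads the partial trace. -/
theorem run_reset {n m : ℕ} (ρ : Op (n + m)) :
    run (fun _ : Fin 1 => oneQubitGate resetKraus resetKraus_complete) (ladder 0 n m) (load ρ) =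
      load (traceOut ρ) := by
  classical
  funext x y
  rw [run_ladder]
  simp only [krausKernel_resetKraus, Finset.prod_ite_zero, Finset.prod_const_one,
    load_setBits]
  simp only [load, traceOut, Matrix.of_apply]
  by_cases h : ∀ i, n ≤ i → x i = false ∧ y i = false
  · have h1 : ∀ i, n + m ≤ i → x i = false ∧ y i = false := fun i hi => h i (by omega)
    rw [if_pos h]
    simp only [if_pos h1]
    refine Finset.sum_congr rfl fun u _ => ?_
    rw [Finset.sum_eq_single u]
    · simp [h]
    · intro v _ hv
      obtain ⟨i, hi⟩ := Function.ne_iff.1 hv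
      rw [if_neg, zero_mul]
      exact fun h' => hi (h' i (Finset.mem_univ i)).2.2.symm
    · simp
  · rw [if_neg h]
    refine Finset.sum_eq_zero fun u _ => Finset.sum_eq_zero fun v _ => ?_
    by_cases h1 : ∀ i, n + m ≤ i → x i = false ∧ y i = false
    · rw [if_neg, zero_mul]
      intro h2
      refine h fun i hi => ?_
      rcases lt_or_ge i (n + m) with hlt | hge
      · have h3 := h2 ⟨i - n, by omega⟩ (Finset.mem_univ _)
        simp only [Nat.add_sub_cancel' hi] at h3
        exact ⟨h3.1, h3.2.1⟩
      · exact h1 i hge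
    · rw [if_neg h1, mul_zero]

theorem efficient_traceOut (m κ : ℕ → ℕ) :
    Efficient (params m κ) (fun n => n + m n) (fun n => n) fun _ ρ => traceOut ρ :=
  efficient_ladder (x := 0) (b := 1) resetKraus resetKraus_complete (by decide)
    fun _ ρ => run_reset ρ

/-! #### Depolarizing noise -/

/-- Kraus operators of the depolarizing channel. -/
noncomputable def depolKraus (p : ℝ) (s : Fin 4) : Matrix Bool Bool ℂ :=
  ((√(depolWeight p s) : ℝ) : ℂ) • pauli s

theorem depolWeight_nonneg {p : ℝ} (h0 : 0 ≤ p) (h1 : p ≤ 1) (s : Fin 4) :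
    0 ≤ depolWeight p s := by
  fin_cases s <;> simp [depolWeight] <;> linarith

theorem sum_depolWeight (p : ℝ) : ∑ s, depolWeight p s = 1 := by
  simp [depolWeight, Fin.sum_univ_four]
  ring

theorem pauli_conjTranspose_mul_self (s : Fin 4) : (pauli s)ᴴ * pauli s = 1 := by
  ext x y
  fin_cases s <;> cases x <;> cases y <;> simp [pauli, Matrix.mul_apply]

theorem pauli_mul_conjTranspose_self (s : Fin 4) : pauli s * (pauli s)ᴴ = 1 :=
  mul_eq_one_comm.1 (pauli_conjTranspose_mul_self s)

theorem depolKraus_complete {p : ℝ} (h0 : 0 ≤ p) (h1 : p ≤ 1) :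
    ∑ s, (depolKraus p s)ᴴ * depolKraus p s = 1 := by
  have h : ∀ s, (depolKraus p s)ᴴ * depolKraus p s = ((depolWeight p s : ℝ) : ℂ) • 1 := by
    intro s
    rw [depolKraus, Matrix.conjTranspose_smul, Matrix.smul_mul, Matrix.mul_smul, smul_smul,
      pauli_conjTranspose_mul_self, Complex.star_def, Complex.conj_ofReal, ← Complex.ofReal_mul,
      Real.mul_self_sqrt (depolWeight_nonneg h0 h1 s)]
  rw [Finset.sum_congr rfl fun s _ => h s, ← Finset.sum_smul, ← Complex.ofReal_sum,
    sum_depolWeight, Complex.ofReal_one, one_smul]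

theorem krausKernel_depolKraus {p : ℝ} (h0 : 0 ≤ p) (h1 : p ≤ 1) (x y u v : Bool) :
    krausKernel (depolKraus p) x y u v =
      ∑ s, ((depolWeight p s : ℝ) : ℂ) * (pauli s x u * star (pauli s y v)) := by
  refine Finset.sum_congr rfl fun s _ => ?_
  have h : ((depolWeight p s : ℝ) : ℂ) = ((√(depolWeight p s) : ℝ) : ℂ) * √(depolWeight p s) := by
    rw [← Complex.ofReal_mul, Real.mul_self_sqrt (depolWeight_nonneg h0 h1 s)]
  rw [h, depolKraus, Matrix.smul_apply, Matrix.smul_apply, smul_eq_mul, smul_eq_mul, star_mul',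
    Complex.star_def, Complex.conj_ofReal]
  ring

theorem localDepolarizing_apply (p : ℝ) {n : ℕ} (ρ : Op n) (x y : Bits n) :
    localDepolarizing p n ρ x y = ∑ u, ∑ v, (∏ i, ∑ s, ((depolWeight p s : ℝ) : ℂ) *
      (pauli s (x i) (u i) * star (pauli s (y i) (v i)))) * ρ u v := by
  simp only [localDepolarizing, Matrix.sum_apply, Matrix.smul_apply, Matrix.mul_apply,
    Matrix.conjTranspose_apply, smul_eq_mul, pauliString, Matrix.of_apply,
    Finset.prod_univ_sum, Fintype.piFinset_univ, Finset.sum_mul, Finset.mul_sum]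
  rw [Finset.sum_comm_cycle]
  refine Finset.sum_congr rfl fun u _ => ?_
  rw [Finset.sum_comm]
  refine Finset.sum_congr rfl fun v _ => Finset.sum_congr rfl fun s _ => ?_
  rw [Finset.prod_mul_distrib, Finset.prod_mul_distrib, star_prod, Complex.ofReal_prod]
  ring

theorem run_depol {p : ℝ} (h0 : 0 ≤ p) (h1 : p ≤ 1) {n : ℕ} (ρ : Op n) :
    run (fun _ : Fin 1 => oneQubitGate (depolKraus p) (depolKraus_complete h0 h1))
      (ladder 0 0 n) (load ρ) = load (localDepolarizing p n ρ) := by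
  classical
  funext x y
  rw [run_ladder]
  simp only [load_setBits_zero, krausKernel_depolKraus h0 h1]
  simp only [load, localDepolarizing_apply]
  split_ifs
  · simp only [zero_add]
  · simp

theorem efficient_localDepolarizing {p : ℝ} (h0 : 0 ≤ p) (h1 : p ≤ 1) (m κ : ℕ → ℕ) :
    Efficient (params m κ) (fun n => n) (fun n => n) fun n => localDepolarizing p n :=
  efficient_ladder (x := 3) (b := 0) _ (depolKraus_complete h0 h1) (by decide)
    fun _ ρ => run_depol h0 h1 ρ

/-! #### Uniformly random bits -/

/-- At $p=1$ all four Pauli weights equal $1/4$ and the channel is $X\mapsto \mathrm{tr}(X)\,I/2$.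
It plays the role of a fair coin. -/
theorem depol_one_kernel (x y u v : Bool) :
    ∑ s, ((depolWeight 1 s : ℝ) : ℂ) * (pauli s x u * star (pauli s y v)) =
      if x = y ∧ u = v then 2⁻¹ else 0 := by
  cases x <;> cases y <;> cases u <;> cases v <;>
    simp [Fin.sum_univ_four, depolWeight, pauli] <;> norm_num

theorem localDepolarizing_one_basisState {n : ℕ} (k : Bits n) :
    localDepolarizing 1 n (basisState k) = maxMixed n := by
  ext x y
  rw [localDepolarizing_apply]
  simp only [depol_one_kernel, Finset.prod_ite_zero, Finset.prod_const, Finset.card_univ,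
    Fintype.card_fin, basisState, maxMixed, Matrix.smul_apply, Matrix.one_apply, smul_eq_mul,
    Matrix.single_apply]
  rw [Finset.sum_eq_single k, Finset.sum_eq_single k]
  · by_cases h : x = y
    · subst h; simp
    · obtain ⟨i, hi⟩ := Function.ne_iff.1 h
      rw [if_neg h, if_neg fun h' => hi (h' i (Finset.mem_univ i)).1]
      simp
  · intro v _ hv
    simp [hv.symm]
  · simp
  · intro u _ hu
    simp [hu.symm]
  · simp

/-- Fresh qubits are $|0\rangle$ by convention, so a preparation without input may regard them as an
`n`-qubit basis state. -/
theorem load_basisState_zero (n : ℕ) :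
    load (1 : Op 0) = load (basisState (fun _ => false : Bits n)) := by
  classical
  funext x y
  simp only [load, basisState, Matrix.single_apply]
  by_cases h : ∀ i, x i = false ∧ y i = false
  · simp only [h, and_self, implies_true, if_true]
    rw [Matrix.one_apply, if_pos (Subsingleton.elim _ _)]
  · rw [if_neg fun h' => h fun i => h' i (Nat.zero_le i)]
    split_ifs with h1 h2
    · exfalso
      refine h fun i => ?_
      rcases lt_or_ge i n with hi | hi
      · exact ⟨(congrFun h2.1 ⟨i, hi⟩).symm, (congrFun h2.2 ⟨i, hi⟩).symm⟩
      · exact h1 i hi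
    · rfl
    · rfl

theorem load_zero_dim (ρ : Op 0) : load ρ = ρ default default • load (1 : Op 0) := by
  rw [← load_smul]
  congr 1
  ext a b
  rw [Subsingleton.elim a default, Subsingleton.elim b default]
  simp

/-- The maximally mixed state of as many qubits as given by a public parameter is efficiently
preparable. -/
theorem efficient_maxMixed (m κ N : ℕ → ℕ) (b : Fin 4) (hb : 3 ≠ b)
    (hN : ∀ n, (![n, m n, κ n, 0] : Fin 4 → ℕ) b = N n) :
    Efficient (params m κ) (fun _ => 0) N fun n ρ => ρ default default • maxMixed (N n) := by
  refine efficient_ladder (x := 3) (b := b) _ (depolKraus_complete zero_le_one le_rfl) hb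
    fun n ρ => ?_
  rw [hN, load_zero_dim, run_smul, load_basisState_zero (N n)]
  change _ • run _ (ladder 0 0 _) _ = _
  rw [run_depol zero_le_one le_rfl, localDepolarizing_one_basisState, load_smul]

/-- This identifies a maximally mixed key register with a uniformly random classical key. -/
theorem maxMixed_eq_sum (n : ℕ) : maxMixed n = ((2 : ℂ) ^ n)⁻¹ • ∑ k : Bits n, basisState k := by
  rw [maxMixed]
  congr 1
  ext x y
  simp only [basisState, Matrix.sum_apply, Matrix.single_apply, Matrix.one_apply, ite_and]
  simp

theorem pauliString_mul_conjTranspose_self {n : ℕ} (s : Fin n → Fin 4) :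
    pauliString s * (pauliString s)ᴴ = 1 := by
  ext x y
  have h : ∀ i, ∑ u, pauli (s i) (x i) u * star (pauli (s i) (y i) u) =
      (1 : Matrix Bool Bool ℂ) (x i) (y i) := fun i => by
    rw [← pauli_mul_conjTranspose_self (s i)]
    rfl
  simp only [Matrix.mul_apply, Matrix.conjTranspose_apply, pauliString, Matrix.of_apply,
    star_prod, ← Finset.prod_mul_distrib]
  rw [← Fintype.piFinset_univ, ← Finset.prod_univ_sum (fun _ => Finset.univ)
    fun i u => pauli (s i) (x i) u * star (pauli (s i) (y i) u), Finset.prod_congr rfl fun i _ => h i]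
  simp only [Matrix.one_apply, Finset.prod_ite_zero, Finset.prod_const_one, funext_iff,
    Finset.mem_univ, true_imp_iff]

theorem sum_prod_depolWeight (p : ℝ) (n : ℕ) :
    ∑ s : Fin n → Fin 4, ∏ i, depolWeight p (s i) = 1 := by
  rw [← Fintype.piFinset_univ, ← Finset.prod_univ_sum (fun _ => Finset.univ)
    fun _ s => depolWeight p s]
  simp [sum_depolWeight]

theorem localDepolarizing_maxMixed (p : ℝ) (n : ℕ) :
    localDepolarizing p n (maxMixed n) = maxMixed n := by
  simp only [localDepolarizing, maxMixed, Matrix.mul_smul, Matrix.smul_mul, mul_one,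
    pauliString_mul_conjTranspose_self]
  rw [← Finset.sum_smul, ← Complex.ofReal_sum, sum_prod_depolWeight, Complex.ofReal_one, one_smul]

/-! ### The first moment of Haar random states -/

section Sphere

variable {E : Type*} [NormedAddCommGroup E] [InnerProductSpace ℝ E] [FiniteDimensional ℝ E]
  [MeasurableSpace E] [BorelSpace E]

/-- The homeomorphism of the unit sphere induced by a linear isometry. -/
def sphereHomeomorph (f : E ≃ₗᵢ[ℝ] E) :
    Metric.sphere (0 : E) 1 ≃ₜ Metric.sphere (0 : E) 1 where
  toFun v := ⟨f v, by simp⟩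
  invFun v := ⟨f.symm v, by simp⟩
  left_inv v := by ext; simp
  right_inv v := by ext; simp
  continuous_toFun := by fun_prop
  continuous_invFun := by fun_prop

open scoped Pointwise in
-- Up to a constant, surface measure is the volume of the cone over a set, and a linear isometry
-- commutes with taking cones.
theorem measurePreserving_sphereHomeomorph (f : E ≃ₗᵢ[ℝ] E) :
    MeasurePreserving (sphereHomeomorph f) (volume : Measure E).toSphere
      (volume : Measure E).toSphere := by
  refine ⟨(sphereHomeomorph f).continuous.measurable, Measure.ext fun s hs => ?_⟩
  have hf := (sphereHomeomorph f).continuous.measurable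
  rw [Measure.map_apply hf hs, Measure.toSphere_apply' _ (hf hs), Measure.toSphere_apply' _ hs]
  congr 1
  have h : Set.Ioo (0 : ℝ) 1 • ((↑) '' (sphereHomeomorph f ⁻¹' s) : Set E) =
      f ⁻¹' (Set.Ioo (0 : ℝ) 1 • ((↑) '' s)) := by
    ext v
    simp only [Set.mem_smul, Set.mem_image, Set.mem_preimage]
    constructor
    · rintro ⟨c, hc, _, ⟨w, hw, rfl⟩, rfl⟩
      exact ⟨c, hc, _, ⟨_, hw, rfl⟩, by simp [sphereHomeomorph]⟩
    · rintro ⟨c, hc, _, ⟨w, hw, rfl⟩, h⟩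
      refine ⟨c, hc, _, ⟨(sphereHomeomorph f).symm w, by simpa using hw, rfl⟩, ?_⟩
      apply f.injective
      simp [← h, sphereHomeomorph]
  rw [h]
  exact f.measurePreserving.measure_preimage_emb f.toHomeomorph.measurableEmbedding _

end Sphere

variable {N : ℕ}

instance isProbabilityMeasure_haarState : IsProbabilityMeasure (haarState N) := by
  refine ⟨?_⟩
  rw [haarState, Measure.smul_apply, smul_eq_mul]
  exact ENNReal.inv_mul_cancel (by
    rw [Ne, Measure.measure_univ_eq_zero]
    exact Measure.toSphere_ne_zero _) (measure_ne_top _ _)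

theorem integral_haarState_comp
    (f : EuclideanSpace ℂ (Bits N) ≃ₗᵢ[ℝ] EuclideanSpace ℂ (Bits N))
    (φ : EuclideanSpace ℂ (Bits N) → ℂ) :
    ∫ v, φ (f v.1) ∂(haarState N) = ∫ v, φ v.1 ∂(haarState N) := by
  rw [haarState, integral_smul_measure, integral_smul_measure]
  congr 1
  exact (measurePreserving_sphereHomeomorph f).integral_comp
    (sphereHomeomorph f).measurableEmbedding fun v => φ v.1

theorem continuous_coord_mul (x y : Bits N) :
    Continuous fun v : Metric.sphere (0 : EuclideanSpace ℂ (Bits N)) 1 =>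
      v.1 x * star (v.1 y) := by
  fun_prop

theorem integrable_haarState {F : Type*} [NormedAddCommGroup F]
    {φ : Metric.sphere (0 : EuclideanSpace ℂ (Bits N)) 1 → F}
    (hφ : Continuous φ) : Integrable φ (haarState N) := by
  exact hφ.integrable_of_hasCompactSupport (HasCompactSupport.of_compactSpace φ)

/-- Two symmetries suffice. Swapping coordinates makes the diagonal moments equal, and they sum to
1; negating coordinate `x` changes the sign of an off-diagonal moment, which therefore vanishes. -/
theorem integral_haarState_coord (x y : Bits N) :
    ∫ v, v.1 x * star (v.1 y) ∂(haarState N) = maxMixed N x y := by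
  classical
  simp only [maxMixed, Matrix.smul_apply, Matrix.one_apply, smul_eq_mul]
  split_ifs with hxy
  · subst hxy
    have hsame : ∀ y : Bits N, ∫ v, v.1 y * star (v.1 y) ∂(haarState N) =
        ∫ v, v.1 x * star (v.1 x) ∂(haarState N) := fun y => by
      rw [← integral_haarState_comp
        (LinearIsometryEquiv.piLpCongrLeft 2 ℝ ℂ (Equiv.swap x y)) fun v => v y * star (v y)]
      simp [LinearIsometryEquiv.piLpCongrLeft_apply]
    have hsum : ∑ y : Bits N, ∫ v, v.1 y * star (v.1 y) ∂(haarState N) = 1 := by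
      rw [← integral_finsetSum _ fun y _ => integrable_haarState (continuous_coord_mul y y)]
      have : ∀ v : Metric.sphere (0 : EuclideanSpace ℂ (Bits N)) 1,
          ∑ y, v.1 y * star (v.1 y) = 1 := fun v => by
        have h : ‖v.1‖ = 1 := by simp
        rw [EuclideanSpace.norm_eq, Real.sqrt_eq_one] at h
        simp only [Complex.star_def, Complex.mul_conj, Complex.normSq_eq_norm_sq]
        exact_mod_cast h
      simp only [this, integral_const, probReal_univ, one_smul]
    rw [Finset.sum_congr rfl fun y _ => hsame y, Finset.sum_const, nsmul_eq_mul,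
      Finset.card_univ] at hsum
    simp only [Fintype.card_pi, Fintype.card_bool, Finset.prod_const, Finset.card_univ,
      Fintype.card_fin, Nat.cast_pow, Nat.cast_ofNat] at hsum
    rw [mul_one]
    exact eq_inv_of_mul_eq_one_right hsum
  · have h := integral_haarState_comp
      (LinearIsometryEquiv.piLpCongrRight 2 fun i : Bits N =>
        if i = x then LinearIsometryEquiv.neg ℝ else .refl ℝ ℂ) fun v => v x * star (v y)
    have hy : ¬ y = x := fun h => hxy h.symm
    simp only [LinearIsometryEquiv.piLpCongrRight_apply, if_true, hy, if_false,
      LinearIsometryEquiv.coe_neg, LinearIsometryEquiv.coe_refl, id_eq, neg_mul,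
      integral_neg] at h
    rw [mul_zero]
    exact CharZero.neg_eq_self_iff.1 h

/-- Averaging a linear functional of a Haar random state. -/
theorem integral_acceptProb_haarState (L : Op N →ₗ[ℂ] Op 1) :
    ∫ v, acceptProb (L (ketBra fun x => v.1 x)) ∂(haarState N) = acceptProb (L (maxMixed N)) := by
  classical
  have hL : ∀ X : Op N, acceptProb (L X) =
      (∑ x, ∑ y, X x y * L (Matrix.single x y 1) (fun _ => true) (fun _ => true)).re := by
    intro X
    conv_lhs => rw [Matrix.matrix_eq_sum_single X]
    rw [acceptProb, map_sum, Matrix.sum_apply]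
    congr 1
    refine Finset.sum_congr rfl fun x _ => ?_
    rw [map_sum, Matrix.sum_apply]
    refine Finset.sum_congr rfl fun y _ => ?_
    have : Matrix.single x y (X x y) = X x y • Matrix.single x y (1 : ℂ) := by
      rw [Matrix.smul_single, smul_eq_mul, mul_one]
    rw [this, map_smul, Matrix.smul_apply, smul_eq_mul]
  have hi : ∀ x y : Bits N, Integrable (fun v : Metric.sphere (0 : EuclideanSpace ℂ (Bits N)) 1 =>
      v.1 x * star (v.1 y) * L (Matrix.single x y 1) (fun _ => true) (fun _ => true))
      (haarState N) := fun x y => (integrable_haarState (continuous_coord_mul x y)).mul_const _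
  simp only [hL, ketBra, Matrix.vecMulVec_apply, Pi.star_apply]
  have hre := integral_re (𝕜 := ℂ) (integrable_finsetSum Finset.univ fun x _ =>
    integrable_finsetSum Finset.univ fun y _ => hi x y)
  simp only [RCLike.re_to_complex] at hre
  rw [hre, integral_finsetSum _ fun x _ => integrable_finsetSum Finset.univ fun y _ => hi x y]
  congr 1
  refine Finset.sum_congr rfl fun x _ => ?_
  rw [integral_finsetSum _ fun y _ => hi x y]
  refine Finset.sum_congr rfl fun y _ => ?_
  rw [integral_mul_const, integral_haarState_coord]

/-! ### Testing with a projection -/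

section ProjTrace

variable {N : ℕ}

/-- The linear functional `X ↦ tr (Π X)`, with `Π` the orthogonal projection onto `W`. -/
noncomputable def projTrace (W : Submodule ℂ (EuclideanSpace ℂ (Bits N))) : Op N →ₗ[ℂ] ℂ where
  toFun X := LinearMap.trace ℂ _ (W.starProjection.toLinearMap ∘ₗ Matrix.toEuclideanLin X)
  map_add' X Y := by rw [map_add, LinearMap.comp_add, map_add]
  map_smul' c X := by rw [map_smul, LinearMap.comp_smul, map_smul]; rfl

variable (W : Submodule ℂ (EuclideanSpace ℂ (Bits N)))

theorem projTrace_eq_sum {ι : Type*} [Fintype ι] (X : Op N)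
    (b : OrthonormalBasis ι ℂ (EuclideanSpace ℂ (Bits N))) :
    projTrace W X = ∑ i, inner ℂ (b i) (W.starProjection (Matrix.toEuclideanLin X (b i))) :=
  LinearMap.trace_eq_sum_inner _ b

theorem projTrace_one : projTrace W 1 = Module.finrank ℂ W := by
  have h : LinearMap.IsProj W W.starProjection.toLinearMap :=
    ⟨fun x => W.starProjection_apply_mem x, fun x hx => W.starProjection_eq_self_iff.2 hx⟩
  rw [← h.trace]
  simp only [projTrace, LinearMap.coe_mk, AddHom.coe_mk]
  congr 1
  ext x
  simp

theorem projTrace_ketBra (v : Bits N → ℂ) :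
    projTrace W (ketBra v) =
      inner ℂ (WithLp.toLp 2 v) (W.starProjection (WithLp.toLp 2 v)) := by
  have h : ∀ u : EuclideanSpace ℂ (Bits N), Matrix.toEuclideanLin (ketBra v) u =
      (inner ℂ (WithLp.toLp 2 v) u : ℂ) • WithLp.toLp 2 v := by
    intro u
    ext x
    simp only [ketBra, Matrix.ofLp_toLpLin, Matrix.toLin'_apply, Matrix.mulVec, dotProduct,
      Matrix.vecMulVec_apply, Pi.star_apply, PiLp.smul_apply, smul_eq_mul, PiLp.inner_apply,
      Finset.sum_mul]
    refine Finset.sum_congr rfl fun y _ => ?_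
    simp
    ring
  let b := EuclideanSpace.basisFun (Bits N) ℂ
  rw [projTrace_eq_sum W _ b, ← b.sum_inner_mul_inner]
  refine Finset.sum_congr rfl fun i _ => ?_
  rw [h, map_smul, inner_smul_right]

theorem projTrace_ketBra_nonneg (v : Bits N → ℂ) : 0 ≤ (projTrace W (ketBra v)).re := by
  have h := W.inner_starProjection_left_eq_right (WithLp.toLp 2 v)
    (W.starProjection (WithLp.toLp 2 v))
  rw [W.starProjection_eq_self_iff.2 (W.starProjection_apply_mem _)] at h
  rw [projTrace_ketBra, ← h]
  exact inner_self_nonneg (𝕜 := ℂ)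

theorem projTrace_ketBra_of_mem (v : Bits N → ℂ) (hv : WithLp.toLp 2 v ∈ W) :
    (projTrace W (ketBra v)).re = ∑ x, ‖v x‖ ^ 2 := by
  rw [projTrace_ketBra, W.starProjection_eq_self_iff.2 hv]
  refine (inner_self_eq_norm_sq (𝕜 := ℂ) _).trans ?_
  rw [EuclideanSpace.norm_sq_eq]

/-- In an orthonormal eigenbasis $u_i$ of $A^\dagger A$ the norms $\|Au_i\|$ are the singular
values. Cauchy–Schwarz and contractivity of the projection bound each diagonal term of the trace. -/
theorem re_projTrace_le_traceNorm (A : Op N) : (projTrace W A).re ≤ traceNorm A := by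
  have hA := Matrix.isHermitian_conjTranspose_mul_self A
  rw [projTrace_eq_sum W A hA.eigenvectorBasis, Complex.re_sum, traceNorm]
  refine Finset.sum_le_sum fun i _ => ?_
  set u := hA.eigenvectorBasis i with hu
  have hn : ‖Matrix.toEuclideanLin A u‖ ^ 2 = hA.eigenvalues i := by
    have h1 : Matrix.toEuclideanLin (Aᴴ * A) u = (hA.eigenvalues i : ℂ) • u := by
      ext x
      rw [Matrix.ofLp_toLpLin, Matrix.toLin'_apply, hA.mulVec_eigenvectorBasis i]
      simp [hu]
    have h2 : Matrix.toEuclideanLin (Aᴴ * A) u =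
        LinearMap.adjoint (Matrix.toEuclideanLin A) (Matrix.toEuclideanLin A u) := by
      rw [← Matrix.toEuclideanLin_conjTranspose_eq_adjoint]
      ext x
      simp [Matrix.mulVec_mulVec]
    have h3 : (inner ℂ (Matrix.toEuclideanLin A u) (Matrix.toEuclideanLin A u) : ℂ) =
        (hA.eigenvalues i : ℂ) := by
      rw [← LinearMap.adjoint_inner_right, ← h2, h1, inner_smul_right, inner_self_eq_norm_sq_to_K,
        hu, hA.eigenvectorBasis.norm_eq_one]
      simp
    rw [inner_self_eq_norm_sq_to_K] at h3
    apply Complex.ofReal_injective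
    rw [← h3, Complex.ofReal_pow]
    rfl
  calc (inner ℂ u (W.starProjection (Matrix.toEuclideanLin A u)) : ℂ).re
      ≤ ‖u‖ * ‖W.starProjection (Matrix.toEuclideanLin A u)‖ := re_inner_le_norm (𝕜 := ℂ) _ _
    _ ≤ 1 * ‖Matrix.toEuclideanLin A u‖ := by
      rw [hu, hA.eigenvectorBasis.norm_eq_one, ← hu]
      gcongr
      exact W.norm_starProjection_apply_le _
    _ = √(hA.eigenvalues i) := by rw [← hn, Real.sqrt_sq (norm_nonneg _), one_mul]

end ProjTrace

/-! ### Entropy and typical strings -/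

section Entropy

theorem sum_prod_mul_apply {ι : Type*} [Fintype ι] (w : ι → ℝ) (hw : ∑ a, w a = 1) (f : ι → ℝ)
    {n : ℕ} (i : Fin n) :
    ∑ s : Fin n → ι, (∏ j, w (s j)) * f (s i) = ∑ a, w a * f a := by
  classical
  have h : ∀ s : Fin n → ι, (∏ j, w (s j)) * f (s i) =
      ∏ j, (w (s j) * if j = i then f (s j) else 1) := fun s => by
    rw [Finset.prod_mul_distrib, Finset.prod_ite_eq' Finset.univ i]
    simp
  rw [Finset.sum_congr rfl fun s _ => h s, ← Fintype.piFinset_univ,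
    ← Finset.prod_univ_sum (fun _ => Finset.univ) fun j a => w a * if j = i then f a else 1,
    Finset.prod_eq_single i]
  · simp
  · intro j _ hj
    simp [hj, hw]
  · simp

/-- Additivity of entropy: the surprisal of a string is a sum over coordinates, and each coordinate
has marginal `w`. Strings of weight zero contribute nothing on either side. -/
theorem sum_negMulLog_prod {ι : Type*} [Fintype ι] (w : ι → ℝ) (hw : ∑ a, w a = 1) (n : ℕ) :
    ∑ s : Fin n → ι, Real.negMulLog (∏ i, w (s i)) = n * ∑ a, Real.negMulLog (w a) := by
  have h : ∀ s : Fin n → ι, Real.negMulLog (∏ i, w (s i)) =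
      ∑ i, (∏ j, w (s j)) * -Real.log (w (s i)) := fun s => by
    rw [← Finset.mul_sum, Real.negMulLog]
    by_cases h0 : ∏ i, w (s i) = 0
    · simp [h0]
    · rw [Real.log_prod fun i _ => Finset.prod_ne_zero_iff.1 h0 i (Finset.mem_univ i)]
      simp
  rw [Finset.sum_congr rfl fun s _ => h s, Finset.sum_comm,
    Finset.sum_congr rfl fun i _ => sum_prod_mul_apply w hw (fun a => -Real.log (w a)) i]
  simp [Real.negMulLog]

/-- A probability distribution of entropy at most `t - 1` bits has a set of points of weight at
least `2 ^ (-t)` whose total probability is at least `1 / t`. -/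
theorem inv_le_sum_typical {ι : Type*} [Fintype ι] (q : ι → ℝ) (h0 : ∀ s, 0 ≤ q s)
    (hq : ∑ s, q s = 1) {t : ℝ} (ht : 0 < t)
    (h : ∑ s, Real.negMulLog (q s) ≤ (t - 1) * Real.log 2) :
    t⁻¹ ≤ ∑ s with (2 : ℝ) ^ (-t) ≤ q s, q s := by
  have hlog : 0 < Real.log 2 := Real.log_pos one_lt_two
  have hle : ∀ s, q s ≤ 1 := fun s => by
    rw [← hq]
    exact Finset.single_le_sum (fun s _ => h0 s) (Finset.mem_univ s)
  -- A Markov argument: atypical points have surprisal at least `t * log 2`. Their total mass is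
  -- thus at most $(t-1)/t$.
  have h1 : ∑ s with ¬ (2 : ℝ) ^ (-t) ≤ q s, q s * (t * Real.log 2) ≤
      ∑ s, Real.negMulLog (q s) := by
    refine (Finset.sum_le_sum fun s hs => ?_).trans (Finset.sum_le_sum_of_subset_of_nonneg
      (Finset.subset_univ _) fun s _ _ => Real.negMulLog_nonneg (h0 s) (hle s))
    rw [Real.negMulLog, neg_mul, ← mul_neg]
    rcases (h0 s).eq_or_lt with hz | hpos
    · simp [← hz]
    refine mul_le_mul_of_nonneg_left ?_ (h0 s)
    have h2 := Real.log_le_log hpos (not_le.1 (Finset.mem_filter.1 hs).2).le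
    rw [Real.log_rpow two_pos] at h2
    linarith
  rw [← Finset.sum_mul] at h1
  have h2 := Finset.sum_filter_add_sum_filter_not Finset.univ (fun s => (2 : ℝ) ^ (-t) ≤ q s) q
  rw [hq] at h2
  have h3 := h1.trans h
  rw [← mul_assoc] at h3
  have h4 := le_of_mul_le_mul_right h3 hlog
  rw [inv_le_iff_one_le_mul₀ ht]
  nlinarith

end Entropy

/-! ### Statistical distance of the noisy states -/

section Far

variable {n m κ : ℕ}

/-- Only $2^m$ unnormalised vectors occur, which is the source of the factor $2^m$ in the later
dimension count. -/
theorem traceOut_ketBra (ψ : Bits (n + m) → ℂ) :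
    traceOut (ketBra ψ) = ∑ z : Bits m, ketBra fun a : Bits n => ψ (Fin.append a z) := by
  ext a b
  simp [traceOut, ketBra, Matrix.sum_apply, Matrix.vecMulVec_apply]

theorem sum_norm_append (ψ : Bits (n + m) → ℂ) :
    ∑ z : Bits m, ∑ a : Bits n, ‖ψ (Fin.append a z)‖ ^ 2 = ∑ x, ‖ψ x‖ ^ 2 := by
  rw [Finset.sum_comm, ← (Fin.appendEquiv n m).sum_comp, Fintype.sum_prod_type]
  rfl

theorem mul_ketBra_mul (P : Op n) (φ : Bits n → ℂ) :
    P * ketBra φ * Pᴴ = ketBra (P *ᵥ φ) := by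
  rw [ketBra, Matrix.mul_vecMulVec, Matrix.vecMulVec_mul, ← Matrix.star_mulVec, ketBra]

theorem sum_norm_mulVec {P : Op n} (hP : Pᴴ * P = 1) (φ : Bits n → ℂ) :
    ∑ x, ‖(P *ᵥ φ) x‖ ^ 2 = ∑ x, ‖φ x‖ ^ 2 := by
  have h : ∀ φ : Bits n → ℂ, ((∑ x, ‖φ x‖ ^ 2 : ℝ) : ℂ) = star φ ⬝ᵥ φ := fun φ => by
    simp only [dotProduct, Pi.star_apply, Complex.star_def, Complex.conj_mul']
    push_cast
    rfl
  apply Complex.ofReal_injective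
  rw [h, h, Matrix.star_mulVec, ← Matrix.dotProduct_mulVec, Matrix.mulVec_mulVec, hP,
    Matrix.one_mulVec]

/-- If the entropy of the noise is small, the noisy mixture of the PRDMs is far from maximally
mixed. -/
theorem le_traceNorm_noisy {p : ℝ} (h0 : 0 ≤ p) (h1 : p ≤ 1)
    (ψ : Bits κ → (Bits (n + m) → ℂ)) (hψ : ∀ k, ∑ x, ‖ψ k x‖ ^ 2 = 1)
    (h : κ + m + n * shannonEntropy (depolWeight p) ≤ n - 2) :
    (2 * (n : ℝ))⁻¹ ≤ traceNorm (localDepolarizing p n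
      (((2 : ℂ) ^ κ)⁻¹ • ∑ k, traceOut (ketBra (ψ k))) - maxMixed n) := by
  classical
  have hlog : 0 < Real.log 2 := Real.log_pos one_lt_two
  let w : (Fin n → Fin 4) → ℝ := fun s => ∏ i, depolWeight p (s i)
  have hw0 : ∀ s, 0 ≤ w s := fun s => Finset.prod_nonneg fun i _ => depolWeight_nonneg h0 h1 _
  have hw1 : ∑ s, w s = 1 := sum_prod_depolWeight p n
  have hH : ∑ s, Real.negMulLog (w s) = n * shannonEntropy (depolWeight p) * Real.log 2 := by
    rw [sum_negMulLog_prod _ (sum_depolWeight p), shannonEntropy, ← Finset.sum_div]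
    field_simp
  have hHnn : 0 ≤ n * shannonEntropy (depolWeight p) := by
    have : 0 ≤ ∑ s, Real.negMulLog (w s) := Finset.sum_nonneg fun s _ =>
      Real.negMulLog_nonneg (hw0 s) (hw1 ▸ Finset.single_le_sum (fun s _ => hw0 s)
        (Finset.mem_univ s))
    rw [hH] at this
    exact nonneg_of_mul_nonneg_left this hlog
  -- The largest threshold for which $2^{\kappa+m}\cdot 2^t/2^n\le 1/2$. The hypothesis says exactly
  -- that the entropy of `w` is at most `t - 1` bits.
  set t : ℝ := n - κ - m - 1 with ht
  have ht1 : 1 ≤ t := by linarith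
  have htn : t ≤ n := by
    have := (Nat.cast_nonneg κ : (0 : ℝ) ≤ κ)
    have := (Nat.cast_nonneg m : (0 : ℝ) ≤ m)
    linarith
  have htyp := inv_le_sum_typical w hw0 hw1 (t := t) (by linarith) (by
    rw [hH]; exact mul_le_mul_of_nonneg_right (by linarith) hlog.le)
  set S : Finset (Fin n → Fin 4) := Finset.univ.filter fun s => (2 : ℝ) ^ (-t) ≤ w s with hS
  let φ : Bits κ → Bits m → (Fin n → Fin 4) → Bits n → ℂ := fun k z s =>
    pauliString s *ᵥ fun a => ψ k (Fin.append a z)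
  let W : Submodule ℂ (EuclideanSpace ℂ (Bits n)) := Submodule.span ℂ
    (Set.range fun i : Bits κ × Bits m × S => WithLp.toLp 2 (φ i.1 i.2.1 i.2.2))
  have hdim : (Module.finrank ℂ W : ℝ) ≤ 2 ^ κ * (2 ^ m * S.card) := by
    have := finrank_range_le_card (R := ℂ)
      fun i : Bits κ × Bits m × S => WithLp.toLp 2 (φ i.1 i.2.1 i.2.2)
    have h2 : Module.finrank ℂ W ≤ 2 ^ κ * (2 ^ m * S.card) := by
      refine this.trans (le_of_eq ?_)
      simp
    exact_mod_cast h2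
  have hmem : ∀ k z, ∀ s ∈ S, WithLp.toLp 2 (φ k z s) ∈ W := fun k z s hs =>
    Submodule.subset_span ⟨(k, z, ⟨s, hs⟩), rfl⟩
  have hcard : S.card * (2 : ℝ) ^ (-t) ≤ ∑ s ∈ S, w s := by
    rw [← nsmul_eq_mul]
    exact Finset.card_nsmul_le_sum _ _ _ fun s hs => (Finset.mem_filter.1 hs).2
  have hexp : localDepolarizing p n (((2 : ℂ) ^ κ)⁻¹ • ∑ k, traceOut (ketBra (ψ k))) =
      ∑ s, ((w s : ℝ) : ℂ) • ((((2 : ℝ) ^ κ)⁻¹ : ℝ) : ℂ) • ∑ k, ∑ z, ketBra (φ k z s) := by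
    rw [localDepolarizing]
    refine Finset.sum_congr rfl fun s _ => ?_
    congr 1
    simp only [traceOut_ketBra, Matrix.mul_smul, Matrix.smul_mul, Matrix.mul_sum, Matrix.sum_mul,
      mul_ketBra_mul]
    push_cast
    rfl
  have hre : ∀ s, (projTrace W (((w s : ℝ) : ℂ) • ((((2 : ℝ) ^ κ)⁻¹ : ℝ) : ℂ) •
      ∑ k, ∑ z, ketBra (φ k z s))).re =
      w s * (((2 : ℝ) ^ κ)⁻¹ * ∑ k, ∑ z, (projTrace W (ketBra (φ k z s))).re) := fun s => by
    rw [map_smul, map_smul, smul_eq_mul, smul_eq_mul, Complex.re_ofReal_mul,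
      Complex.re_ofReal_mul]
    simp only [map_sum, Complex.re_sum]
  -- Terms with `s ∈ S` lie inside `W` and contribute their full weight; the remaining terms are
  -- nonnegative and are dropped.
  have hmain : ∑ s ∈ S, w s ≤ (projTrace W (localDepolarizing p n
      (((2 : ℂ) ^ κ)⁻¹ • ∑ k, traceOut (ketBra (ψ k))))).re := by
    rw [hexp, map_sum, Complex.re_sum]
    simp only [hre]
    refine (Finset.sum_le_sum fun s hs => le_of_eq ?_).trans
      (Finset.sum_le_sum_of_subset_of_nonneg (Finset.subset_univ S) fun s _ _ =>
        mul_nonneg (hw0 s) (mul_nonneg (by positivity) (Finset.sum_nonneg fun k _ =>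
          Finset.sum_nonneg fun z _ => projTrace_ketBra_nonneg W _)))
    have hone : ∀ k, ∑ z, (projTrace W (ketBra (φ k z s))).re = 1 := fun k => by
      rw [← hψ k, ← sum_norm_append]
      refine Finset.sum_congr rfl fun z _ => ?_
      rw [projTrace_ketBra_of_mem W _ (hmem k z s hs)]
      exact sum_norm_mulVec (mul_eq_one_comm.1 (pauliString_mul_conjTranspose_self s)) _
    simp [hone]
  have hmix : (projTrace W (maxMixed n)).re = ((2 : ℝ) ^ n)⁻¹ * Module.finrank ℂ W := by
    have : (2 : ℂ) ^ n = (((2 : ℝ) ^ n : ℝ) : ℂ) := by push_cast; rfl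
    rw [maxMixed, map_smul, projTrace_one, smul_eq_mul, this, ← Complex.ofReal_inv,
      Complex.re_ofReal_mul, Complex.natCast_re]
  have hpow : ((2 : ℝ) ^ n)⁻¹ * (2 ^ κ * (2 ^ m * S.card)) = S.card * (2 : ℝ) ^ (-t) / 2 := by
    have e : -t = κ + m + 1 - n := by rw [ht]; ring
    rw [e, Real.rpow_sub two_pos, Real.rpow_add two_pos, Real.rpow_add two_pos, Real.rpow_one,
      Real.rpow_natCast, Real.rpow_natCast, Real.rpow_natCast]
    field_simp
  have hfin := re_projTrace_le_traceNorm W (localDepolarizing p n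
      (((2 : ℂ) ^ κ)⁻¹ • ∑ k, traceOut (ketBra (ψ k))) - maxMixed n)
  rw [map_sub, Complex.sub_re, hmix] at hfin
  -- Combines the dimension bound with $|S|\,2^{-t}\le w(S)$; the spare $-1$ in `t` gives the factor
  -- 1/2.
  have hb : ((2 : ℝ) ^ n)⁻¹ * Module.finrank ℂ W ≤ (∑ s ∈ S, w s) / 2 := by
    refine (mul_le_mul_of_nonneg_left hdim (by positivity)).trans ?_
    rw [hpow]
    linarith
  have hinv : (n : ℝ)⁻¹ ≤ t⁻¹ := inv_anti₀ (by linarith) htn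
  rw [mul_inv]
  linarith

end Far

/-! ### Robustness of the EFI pair -/

/-- Transport of operators along an equality of the numbers of qubits. -/
def castOp {N M : ℕ} (h : N = M) (ρ : Op N) : Op M :=
  Matrix.of fun a b => ρ (fun i => a (Fin.cast h i)) fun i => b (Fin.cast h i)

theorem load_castOp {N M : ℕ} (h : N = M) (ρ : Op N) : load (castOp h ρ) = load ρ := by
  subst h
  rfl

/-- One copy of an `N`-qubit state formally lives on `1 * N` qubits; the register, and hence the
circuit, does not see the difference. -/
theorem Efficient.castOp_left {pp : ℕ → List ℕ} {N N' M : ℕ → ℕ} {Φ : ∀ n, Op (N n) → Op (M n)}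
    (hΦ : Efficient pp N M Φ) (h : ∀ n, N' n = N n) :
    Efficient pp N' M fun n ρ => Φ n (castOp (h n) ρ) := by
  obtain ⟨r, lib, C, hC, hrun⟩ := hΦ
  refine ⟨r, lib, C, hC, fun n ρ => ?_⟩
  rw [← hrun, load_castOp]

theorem castOp_ketBra_copies_one {N : ℕ} (ψ : Bits N → ℂ) :
    castOp (one_mul N) (ketBra (copies 1 ψ)) = ketBra ψ := by
  have h : ∀ a : Bits N, copies 1 ψ (fun i => a (Fin.cast (one_mul N) i)) = ψ a := by
    intro a
    simp only [copies, Fin.prod_univ_one]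
    congr 1
  ext a b
  simp [castOp, ketBra, Matrix.vecMulVec_apply, h]

theorem traceOut_maxMixed (n m : ℕ) : traceOut (maxMixed (n + m)) = maxMixed n := by
  ext a b
  simp only [traceOut, maxMixed, Matrix.of_apply, Matrix.smul_apply, Matrix.one_apply,
    smul_eq_mul]
  have h : ∀ z : Bits m, (Fin.append a z = Fin.append b z) ↔ a = b := fun z => by
    constructor
    · intro h
      funext i
      simpa using congrFun h (Fin.castAdd m i)
    · rintro rfl
      rfl
  simp only [h, Finset.sum_const, Finset.card_univ, nsmul_eq_mul, Fintype.card_pi,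
    Fintype.card_bool, Finset.prod_const, Fintype.card_fin]
  rw [pow_add]
  push_cast
  field_simp

theorem IsNoiseRate.efficient {m κ : ℕ → ℕ} {p : ℕ → ℝ} (hp : IsNoiseRate (params m κ) p) :
    Efficient (params m κ) (fun n => n) (fun n => n) fun n => localDepolarizing (p n) n := by
  obtain ⟨hp01, ⟨q, hq⟩ | h⟩ := hp
  · have hq01 := hp01 0
    rw [hq] at hq01
    simp only [hq]
    exact efficient_localDepolarizing hq01.1 hq01.2 m κ
  · exact h

/-- Both parts of the theorem reduce to this criterion. The entropy bound enters only through the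
trace distance. -/
theorem robustEFI_of_entropy {m κ : ℕ → ℕ} (ψ : ∀ n, Bits (κ n) → (Bits (n + m n) → ℂ))
    {p : ℕ → ℝ} (hψ : IsPRS (params m κ) (fun n => n + m n) κ ψ)
    (hp : IsNoiseRate (params m κ) p)
    (hH : ∀ᶠ n : ℕ in atTop,
      κ n + m n + n * shannonEntropy (depolWeight (p n)) ≤ (n : ℝ) - 2) :
    RobustEFI ψ p := by
  have hΛ := hp.efficient
  obtain ⟨G, hG, hGψ⟩ := hψ.generation
  obtain ⟨LG, hLG⟩ := hG.exists_linear
  obtain ⟨LT, hLT⟩ := (efficient_traceOut m κ).exists_linear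
  have hmix : ∀ n, ((2 : ℂ) ^ κ n)⁻¹ • ∑ k, prdm ψ n k = traceOut (G n (maxMixed (κ n))) := by
    intro n
    rw [maxMixed_eq_sum, hLG, map_smul, map_sum, hLT, map_smul, map_sum]
    congr 1
    refine Finset.sum_congr rfl fun k _ => ?_
    rw [← hLG, hGψ, ← hLT, prdm]
  -- Exponent 2 absorbs the constant in $1/(2n)$, since $2n\le n^2$ for $n\ge 2$.
  refine ⟨fun b => ?_, ⟨2, ?_⟩, fun A hA => ?_⟩
  · cases b
    -- The unknown key is drawn by preparing a maximally mixed register; counter 2 holds its length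
    -- `κ n`.
    · refine ⟨_, hΛ.comp ((efficient_traceOut m κ).comp
        (hG.comp (efficient_maxMixed m κ κ 2 (by decide) fun n => rfl))), fun n => ?_⟩
      simp only [Matrix.one_apply_eq, one_smul, prdmPair, hmix]
    · refine ⟨_, efficient_maxMixed m κ (fun n => n) 0 (by decide) fun n => rfl, fun n => ?_⟩
      simp only [Matrix.one_apply_eq, one_smul, prdmPair, localDepolarizing_maxMixed]
  · filter_upwards [hH, eventually_ge_atTop 2] with n hn hn2
    have h := le_traceNorm_noisy (hp.1 n).1 (hp.1 n).2 (ψ n) (hψ.unit n) hn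
    simp only [prdmPair, localDepolarizing_maxMixed]
    refine le_trans ?_ h
    have hn2' : (2 : ℝ) ≤ n := by exact_mod_cast hn2
    rw [one_div]
    exact inv_anti₀ (by linarith) (by nlinarith)
  · have hA' := (hA.comp (hΛ.comp (efficient_traceOut m κ))).castOp_left
      fun n => one_mul (n + m n)
    obtain ⟨L, hL⟩ := (hA.comp (hΛ.comp (efficient_traceOut m κ))).exists_linear
    have h := hψ.pseudorandom (fun _ => 1) ⟨1, fun n => by simp⟩ _ hA'
    convert h using 2 with n
    simp only [castOp_ketBra_copies_one, hL]
    rw [integral_acceptProb_haarState]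
    congr 1
    · have hlin : prdmPair ψ false n =
          traceOut (((2 : ℂ) ^ κ n)⁻¹ • ∑ k, ketBra (ψ n k)) := by
        rw [hLT, map_smul, map_sum, prdmPair]
        simp only [← hLT, prdm]
      rw [hlin, hL, map_smul, map_sum]
      have hc : ((2 : ℂ) ^ κ n)⁻¹ = ((((2 : ℝ) ^ κ n)⁻¹ : ℝ) : ℂ) := by push_cast; rfl
      simp only [acceptProb, Matrix.smul_apply, Matrix.sum_apply, smul_eq_mul]
      rw [hc, Complex.re_ofReal_mul, Complex.re_sum]
    · rw [← hL, traceOut_maxMixed, prdmPair]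

/-! ### A numerical bound on the noise entropy -/

/-- The tangent line at `v` of the concave function `Real.negMulLog`. Summed over a distribution, it
bounds entropy by cross entropy, which is linear in the weights. -/
theorem negMulLog_le {x v : ℝ} (hx : 0 ≤ x) (hv : 0 < v) :
    Real.negMulLog x ≤ v - x - x * Real.log v := by
  rcases hx.eq_or_lt with rfl | hx
  · simpa using hv.le
  · have h := Real.log_le_sub_one_of_pos (div_pos hv hx)
    rw [Real.log_div hv.ne' hx.ne'] at h
    have h2 := mul_le_mul_of_nonneg_left h hx.le
    have h3 : x * (v / x - 1) = v - x := by field_simp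
    rw [Real.negMulLog]
    linarith

theorem shannonEntropy_depolWeight_le {p : ℝ} (h0 : 0 ≤ p) (h1 : p ≤ 1 / 4) :
    shannonEntropy (depolWeight p) ≤ 0.99375 := by
  have hlog : 0 < Real.log 2 := Real.log_pos one_lt_two
  have h13 : Real.log (13 / 16) = Real.log 13 - 4 * Real.log 2 := by
    rw [Real.log_div (by norm_num) (by norm_num), show (16 : ℝ) = 2 ^ 4 by norm_num, Real.log_pow]
    norm_num
  have h16 : Real.log (1 / 16) = - (4 * Real.log 2) := by
    rw [one_div, Real.log_inv, show (16 : ℝ) = 2 ^ 4 by norm_num, Real.log_pow]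
    norm_num
  -- From $2^{37}\le 13^{10}$, that is $\log_2 13\ge 3.7$. Cross entropy relative to the weights at
  -- $p=1/4$ is $4-(1-3p/4)\log_2 13$, at most $4-\tfrac{13}{16}\cdot 3.7=0.99375$.
  have hle : 37 * Real.log 2 ≤ 10 * Real.log 13 := by
    have : Real.log (2 ^ 37) ≤ Real.log (13 ^ 10) := Real.log_le_log (by norm_num) (by norm_num)
    rw [Real.log_pow, Real.log_pow] at this
    exact_mod_cast this
  have hlt : Real.log 13 ≤ 4 * Real.log 2 := by
    have : Real.log 13 ≤ Real.log (2 ^ 4) := Real.log_le_log (by norm_num) (by norm_num)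
    rw [Real.log_pow] at this
    exact_mod_cast this
  have e1 := negMulLog_le (x := 1 - 3 * p / 4) (v := 13 / 16) (by linarith) (by norm_num)
  have e2 := negMulLog_le (x := p / 4) (v := 1 / 16) (by linarith) (by norm_num)
  rw [h13] at e1
  rw [h16] at e2
  rw [shannonEntropy, ← Finset.sum_div, div_le_iff₀ hlog]
  simp only [Fin.sum_univ_four, depolWeight, Matrix.cons_val]
  nlinarith

end NoisyEFI

theorem mainTheorem10 :
    (∀ (c : ℝ) (m κ : ℕ → ℕ)
      (ψ : ∀ n, NoisyEFI.Bits (κ n) → (NoisyEFI.Bits (n + m n) → ℂ)) (p : ℕ → ℝ),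
      0 < c → c < 1 →
      Tendsto (fun n : ℕ => (m n : ℝ) / Real.log n) atTop atTop →
      NoisyEFI.IsPRS (NoisyEFI.params m κ) (fun n => n + m n) κ ψ →
      NoisyEFI.IsNoiseRate (NoisyEFI.params m κ) p →
      ((∀ n : ℕ, κ n = ⌊c * n⌋₊) ∧
          ∀ᶠ n : ℕ in atTop, NoisyEFI.shannonEntropy (NoisyEFI.depolWeight (p n)) ≤
            (1 - c) - (m n : ℝ) / n - 2 / n) ∨
        ((∀ n : ℕ, κ n = ⌊c * (n + m n)⌋₊) ∧
          ∀ᶠ n : ℕ in atTop, NoisyEFI.shannonEntropy (NoisyEFI.depolWeight (p n)) ≤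
            (1 - c) - (1 + c) * (m n : ℝ) / n - 2 / n) →
      NoisyEFI.RobustEFI ψ p) ∧
    (∀ m : ℕ → ℕ,
      Tendsto (fun n : ℕ => (m n : ℝ) / Real.log n) atTop atTop →
      (∃ (a : ℝ) (e : ℕ), ∀ᶠ n : ℕ in atTop, (m n : ℝ) ≤ a * Real.log n ^ e) →
      ∃ (C : ℝ) (d : ℕ), 0 ≤ C ∧
        ∀ (κ : ℕ → ℕ) (ψ : ∀ n, NoisyEFI.Bits (κ n) → (NoisyEFI.Bits (n + m n) → ℂ))
          (p : ℕ → ℝ),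
          ((∀ n : ℕ, κ n = ⌊(10 : ℝ) ^ (-4 : ℤ) * n⌋₊) ∨
            (∀ n : ℕ, κ n = ⌊(10 : ℝ) ^ (-4 : ℤ) * (n + m n)⌋₊)) →
          NoisyEFI.IsPRS (NoisyEFI.params m κ) (fun n => n + m n) κ ψ →
          NoisyEFI.IsNoiseRate (NoisyEFI.params m κ) p →
          (∀ᶠ n : ℕ in atTop, p n < 1 / 4 - C * Real.log n ^ d / n) →
          NoisyEFI.RobustEFI ψ p) := by
  refine ⟨fun c m κ ψ p hc0 _ _ hψ hp h => ?_, fun m _ ⟨a, e, hm⟩ => ?_⟩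
  · refine NoisyEFI.robustEFI_of_entropy ψ hψ hp ?_
    rcases h with ⟨hκ, h⟩ | ⟨hκ, h⟩
    · filter_upwards [h, eventually_gt_atTop 0] with n hn hpos
      have hn0 : (0 : ℝ) < n := by exact_mod_cast hpos
      have hle : (κ n : ℝ) ≤ c * n := by
        rw [hκ]; exact Nat.floor_le (by positivity)
      have h2 := mul_le_mul_of_nonneg_left hn hn0.le
      have h3 : (n : ℝ) * (1 - c - m n / n - 2 / n) = n - c * n - m n - 2 := by field_simp
      linarith
    · filter_upwards [h, eventually_gt_atTop 0] with n hn hpos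
      have hn0 : (0 : ℝ) < n := by exact_mod_cast hpos
      have hle : (κ n : ℝ) ≤ c * (n + m n) := by
        rw [hκ]; exact Nat.floor_le (by positivity)
      have h2 := mul_le_mul_of_nonneg_left hn hn0.le
      have h3 : (n : ℝ) * (1 - c - (1 + c) * m n / n - 2 / n) =
          n - c * n - (1 + c) * m n - 2 := by field_simp
      linarith
  -- No correction to the threshold 1/4 is needed, as the entropy bound there leaves a linear slack
  -- of $0.00625\,n$.
  · refine ⟨0, 0, le_rfl, fun κ ψ p hκ hψ hp hlt => ?_⟩
    refine NoisyEFI.robustEFI_of_entropy ψ hψ hp ?_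
    have hlog : ∀ᶠ n : ℕ in atTop, |a| * Real.log n ^ e ≤ 1 / 1000 * n := by
      have h := (Real.isLittleO_pow_log_id_atTop (n := e)).const_mul_left |a|
      have h2 := (h.comp_tendsto tendsto_natCast_atTop_atTop).bound
        (show (0 : ℝ) < 1 / 1000 by norm_num)
      filter_upwards [h2] with n hn
      refine (le_abs_self _).trans ?_
      simpa using hn
    -- For $n\ge 1000$ the slack covers $m\le n/1000$, $\kappa\le (n+m)/10000$ and $2\le n/500$.
    filter_upwards [hlog, hm, hlt, eventually_ge_atTop 1000] with n h1 h2 h3 h4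
    have hn0 : (1000 : ℝ) ≤ n := by exact_mod_cast h4
    have hlog0 : 0 ≤ Real.log n ^ e := pow_nonneg (Real.log_natCast_nonneg n) e
    have hm1 : (m n : ℝ) ≤ 1 / 1000 * n :=
      h2.trans ((mul_le_mul_of_nonneg_right (le_abs_self a) hlog0).trans h1)
    have hle : (κ n : ℝ) ≤ 1 / 10000 * (n + m n) := by
      have hpos : (0 : ℝ) ≤ m n := Nat.cast_nonneg _
      have h10 : (10 : ℝ) ^ (-4 : ℤ) = 1 / 10000 := by norm_num
      rw [h10] at hκ
      rcases hκ with hκ | hκ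
      · rw [hκ]
        refine (Nat.floor_le (by positivity)).trans ?_
        linarith
      · rw [hκ]
        exact Nat.floor_le (by positivity)
    have hH := NoisyEFI.shannonEntropy_depolWeight_le (hp.1 n).1
      (by rw [zero_mul, zero_div, sub_zero] at h3; exact h3.le)
    have hnH := mul_le_mul_of_nonneg_left hH (by linarith : (0 : ℝ) ≤ n)
    norm_num at hnH
    linarith
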